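/- Let $r\ge 1$ and $d_1,\dots,d_r\ge 1$ be integers, let $\mathbb{S}^{\boldsymbol d}=\mathbb{S}^{d_1}\times\cdots\times\mathbb{S}^{d_r}$, where $\mathbb{S}^{d_j}\subset\mathbb{R}^{d_j+1}$ is the unit sphere with surface area measure $\sigma_{d_j}$, let $\sigma_{\boldsymbol d}=\sigma_{d_1}\times\cdots\times\sigma_{d_r}$, and let $\omega_{\boldsymbol d-1}=\prod_{j=1}^r\sigma_{d_j-1}(\mathbb{S}^{d_j-1})$. Let $f$ be a probability density function on $\mathbb{S}^{\boldsymbol d}$ with respect to $\sigma_{\boldsymbol d}$, and let $\boldsymbol X_1,\boldsymbol X_2,\dots$ be independent and identically distributed with density $f$. For a kernel $L:\mathbb{R}_{\ge 0}^r\to\mathbb{R}_{\ge 0}$ and a bandwidth vector $\boldsymbol h=(h_1,\dots,h_r)$ with positive entries, let \[ \hat f(\boldsymbol x;\boldsymbol h)=\frac{c_{\boldsymbol d,L}(\boldsymbol h)}{n}\sum_{i=1}^n L\Big(\frac{1-\boldsymbol x_1'\boldsymbol X_{i,1}}{h_1^2},\dots,\frac{1-\boldsymbol x_r'\boldsymbol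 X_{i,r}}{h_r^2}\Big),\qquad c_{\boldsymbol d,L}(\boldsymbol h)^{-1}=\int_{\mathbb{S}^{\boldsymbol d}}L\Big(\frac{1-\boldsymbol x_1'\boldsymbol y_1}{h_1^2},\dots,\frac{1-\boldsymbol x_r'\boldsymbol y_r}{h_r^2}\Big)\,\sigma_{\boldsymbol d}(\mathrm{d}\boldsymbol x) \] be the kernel density estimator based on $\boldsymbol X_1,\dots,\boldsymbol X_n$ (the last integral does not depend on $\boldsymbol y\in\mathbb{S}^{\boldsymbol d}$). Assume: (A1*) the radial extension $\bar f(\boldsymbol x)=f(\boldsymbol x_1/\|\boldsymbol x_1\|,\dots,\boldsymbol x_r/\|\boldsymbol x_r\|)$ (defined where all $\boldsymbol x_j\in\mathbb{R}^{d_j+1}$ are nonzero) is four times continuously differentiable on $\mathbb{S}^{\boldsymbol d}$, that is, of class $C^4$ in a neighbourhood of each of its points; (A2) $L$ is (measurable and) bounded, and $0<\int_{\mathbb{R}_+^r}L^\ell(\boldsymbol s)\prod_{j=1}^r s_j^{e_j/2-1}\,\mathrm{d}\boldsymbol s<\infty$ for $\ell=1,2$ and all integers $e_1,\dots,e_r\ge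 1$; (A3) $\boldsymbol h_n=(h_{1,n},\dots,h_{r,n})$ is a sequence of vectors with positive entries such that $\boldsymbol h_n\to\boldsymbol 0$ and $n\prod_{j=1}^r h_{j,n}^{d_j}\to\infty$ as $n\to\infty$. Then for every $\boldsymbol x\in\mathbb{S}^{\boldsymbol d}$, as $n\to\infty$ (the expectation being finite for every $n$), \[ \mathbb{E}[\hat f(\boldsymbol x;\boldsymbol h_n)]=f(\boldsymbol x)+\sum_{j=1}^r h_{j,n}^2\,\operatorname{tr}\big(\boldsymbol{\mathcal H}_{jj}\bar f(\boldsymbol x)\big)\,b_{\boldsymbol d,j}(L)+O\Big(\sum_{j=1}^r h_{j,n}^4\Big), \] where $\boldsymbol{\mathcal H}_{jj}\bar f(\boldsymbol x)$ is the $(d_j+1)\times(d_j+1)$ diagonal block of the Hessian matrix of $\bar f$ at $\boldsymbol x$ of the derivatives with respect to $\boldsymbol x_j$, and \[ b_{\boldsymbol d,j}(L)=\frac{\lambda_{\boldsymbol d}(L(\boldsymbol s)s_j)}{d_j\,\lambda_{\boldsymbol d}(L)},\qquad \lambda_{\boldsymbol d}(g)=\omega_{\boldsymbol d-1}\int_{\mathbb{R}_+^r}g(\boldsymbol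 s)\prod_{j=1}^r s_j^{d_j/2-1}2^{d_j/2-1}\,\mathrm{d}\boldsymbol s . \] -/

import Mathlib

open MeasureTheory ProbabilityTheory Filter Asymptotics Matrix

noncomputable section

namespace PolyKDE

/-- The ambient Euclidean space `ℝ^(d+1)` of the sphere `𝕊^d`. -/
abbrev Ambient (d : ℕ) : Type := EuclideanSpace ℝ (Fin (d + 1))

/-- The unit sphere `𝕊^d` in `ℝ^(d+1)`. -/
abbrev Sphere (d : ℕ) : Type := Metric.sphere (0 : Ambient d) 1

/-- The polysphere `𝕊^{d_1} × ⋯ × 𝕊^{d_r}`. -/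
abbrev Polysphere {r : ℕ} (d : Fin r → ℕ) : Type := ∀ j, Sphere (d j)

/-- The surface area measure `σ_d` on `𝕊^d`. -/
def surfaceMeasure (d : ℕ) : Measure (Sphere d) := (volume : Measure (Ambient d)).toSphere

/-- The total surface area `ω_d = σ_d(𝕊^d)`. -/
def sphereArea (d : ℕ) : ℝ := (surfaceMeasure d).real Set.univ

/-- The product measure `σ_{d_1} × ⋯ × σ_{d_r}` on the polysphere. -/
def polyMeasure {r : ℕ} (d : Fin r → ℕ) : Measure (Polysphere d) :=
  Measure.pi fun j => surfaceMeasure (d j)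

/-- `f` is a probability density function on the polysphere. -/
structure IsDensity {r : ℕ} (d : Fin r → ℕ) (f : Polysphere d → ℝ) : Prop where
  nonneg : ∀ y, 0 ≤ f y
  integrable : Integrable f (polyMeasure d)
  integral_eq_one : ∫ y, f y ∂(polyMeasure d) = 1

/-- The point `v / ‖v‖` of the sphere, for `v ≠ 0`. -/
def normalize {d : ℕ} (v : Ambient d) (hv : v ≠ 0) : Sphere d :=
  ⟨‖v‖⁻¹ • v, by
    rw [mem_sphere_zero_iff_norm, norm_smul, norm_inv, norm_norm,
      inv_mul_cancel₀ (norm_ne_zero_iff.mpr hv)]⟩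

open Classical in
/-- The radial extension `f̄(x) = f(x_1/‖x_1‖, …, x_r/‖x_r‖)`, where all blocks `x_j` are nonzero
(elsewhere the value is irrelevant and set to `0`). -/
def radialExt {r : ℕ} (d : Fin r → ℕ) (f : Polysphere d → ℝ) (x : ∀ j, Ambient (d j)) : ℝ :=
  if hx : ∀ j, x j ≠ 0 then f fun j => normalize (x j) (hx j) else 0

/-- A point of the polysphere as a point of `ℝ^{d_1+1} × ⋯ × ℝ^{d_r+1}`. -/
def toAmbient {r : ℕ} {d : Fin r → ℕ} (x : Polysphere d) : ∀ j, Ambient (d j) :=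
  fun j => (x j : Ambient (d j))

/-- `f̄` is four times continuously differentiable on the polysphere: at each of its points, `f̄` is
of class `C⁴` in a neighbourhood in the ambient space. -/
def RadialC4 {r : ℕ} (d : Fin r → ℕ) (f : Polysphere d → ℝ) : Prop :=
  ∀ x : Polysphere d, ContDiffAt ℝ 4 (radialExt d f) (toAmbient x)

/-- The `a`-th coordinate vector of the `j`-th block of `ℝ^{d_1+1} × ⋯ × ℝ^{d_r+1}`. -/
def blockBasis {r : ℕ} (d : Fin r → ℕ) (j : Fin r) (a : Fin (d j + 1)) : ∀ k, Ambient (d k) :=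
  Pi.single j (EuclideanSpace.single a (1 : ℝ))

/-- The `j`-th diagonal block `𝓗_jj g(x)` of the Hessian matrix of `g` at `x`. -/
def hessianBlock {r : ℕ} (d : Fin r → ℕ) (g : (∀ k, Ambient (d k)) → ℝ) (x : ∀ k, Ambient (d k))
    (j : Fin r) : Matrix (Fin (d j + 1)) (Fin (d j + 1)) ℝ :=
  Matrix.of fun a b => iteratedFDeriv ℝ 2 g x ![blockBasis d j a, blockBasis d j b]

/-- The diagonal matrix `𝓣 g(x)` with entries `tr 𝓗_jj g(x)`. -/
def curvatureMatrix {r : ℕ} (d : Fin r → ℕ) (g : (∀ k, Ambient (d k)) → ℝ)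
    (x : ∀ k, Ambient (d k)) : Matrix (Fin r) (Fin r) ℝ :=
  Matrix.diagonal fun j => (hessianBlock d g x j).trace

/-- The open orthant `ℝ_+^r`. -/
def posOrthant (r : ℕ) : Set (Fin r → ℝ) := {s | ∀ j, 0 < s j}

/-- The standing assumption on the kernel `L : ℝ_{≥0}^r → ℝ_{≥0}`: it is (measurable and) bounded,
and for `ℓ = 1, 2` and all integers `e_1, …, e_r ≥ 1` the integral of `L^ℓ ∏ s_j^{e_j/2-1}` over
`ℝ_+^r` is positive and finite. Values of `L` outside the closed orthant are never used. -/
structure IsKernel {r : ℕ} (L : (Fin r → ℝ) → ℝ) : Prop where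
  measurable : Measurable L
  nonneg : ∀ s, (∀ j, 0 ≤ s j) → 0 ≤ L s
  bounded : ∃ M : ℝ, ∀ s, (∀ j, 0 ≤ s j) → L s ≤ M
  integrable : ∀ l : ℕ, (l = 1 ∨ l = 2) → ∀ e : Fin r → ℕ, (∀ j, 1 ≤ e j) →
    IntegrableOn (fun s => L s ^ l * ∏ j, s j ^ ((e j : ℝ) / 2 - 1)) (posOrthant r)
  integral_pos : ∀ l : ℕ, (l = 1 ∨ l = 2) → ∀ e : Fin r → ℕ, (∀ j, 1 ≤ e j) →
    0 < ∫ s in posOrthant r, L s ^ l * ∏ j, s j ^ ((e j : ℝ) / 2 - 1)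

/-- `ρ(h) = ∏ h_j^{d_j}`. -/
def rho {r : ℕ} (d : Fin r → ℕ) (h : Fin r → ℝ) : ℝ := ∏ j, h j ^ d j

/-- The assumption on the bandwidths: `h_n ∈ ℝ_+^r`, `h_n → 0` and `n ρ(h_n) → ∞`. -/
structure IsBandwidth {r : ℕ} (d : Fin r → ℕ) (h : ℕ → Fin r → ℝ) : Prop where
  pos : ∀ n j, 0 < h n j
  tendsto_zero : Tendsto h atTop (nhds 0)
  tendsto_rho : Tendsto (fun n : ℕ => (n : ℝ) * rho d (h n)) atTop atTop

/-- The unnormalized kernel `L((1 - x_1'y_1)/h_1², …, (1 - x_r'y_r)/h_r²)`. -/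
def rawKernel {r : ℕ} {d : Fin r → ℕ} (L : (Fin r → ℝ) → ℝ) (h : Fin r → ℝ)
    (x y : Polysphere d) : ℝ :=
  L fun j => (1 - inner ℝ (x j : Ambient (d j)) (y j : Ambient (d j))) / h j ^ 2

/-- The reference point of the polysphere, all of whose blocks are `(1, 0, …, 0)`. -/
def pole {r : ℕ} (d : Fin r → ℕ) : Polysphere d :=
  fun j => ⟨EuclideanSpace.single (0 : Fin (d j + 1)) (1 : ℝ), by simp⟩

/-- The normalizing constant `c_{d,L}(h)`, the inverse of the integral
`∫ L((1 - x_1'y_1)/h_1², …, (1 - x_r'y_r)/h_r²) σ(dx)`. By rotation invariance, this integral does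
not depend on the point `y`, which is taken to be the pole. -/
def normConst {r : ℕ} (d : Fin r → ℕ) (L : (Fin r → ℝ) → ℝ) (h : Fin r → ℝ) : ℝ :=
  (∫ x, rawKernel L h x (pole d) ∂(polyMeasure d))⁻¹

/-- The normalized kernel `L_h(x, y)`. -/
def normKernel {r : ℕ} (d : Fin r → ℕ) (L : (Fin r → ℝ) → ℝ) (h : Fin r → ℝ)
    (x y : Polysphere d) : ℝ :=
  normConst d L h * rawKernel L h x y

/-- The kernel density estimator `f̂(x; h) = n⁻¹ ∑ L_h(x, X_i)` of a sample of size `n`. -/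
def kde {r : ℕ} (d : Fin r → ℕ) (L : (Fin r → ℝ) → ℝ) (h : Fin r → ℝ) {n : ℕ}
    (sample : Fin n → Polysphere d) (x : Polysphere d) : ℝ :=
  1 / (n : ℝ) * ∑ i, normKernel d L h x (sample i)

/-- `λ_d(L) = ω_{d-1} ∫_{ℝ_+^r} L(s) ∏ s_j^{d_j/2-1} 2^{d_j/2-1} ds`, for `d_1, …, d_r ≥ 1`. -/
def lam {r : ℕ} (d : Fin r → ℕ) (L : (Fin r → ℝ) → ℝ) : ℝ :=
  (∏ j, sphereArea (d j - 1)) *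
    ∫ s in posOrthant r, L s * ∏ j, (s j ^ ((d j : ℝ) / 2 - 1) * (2 : ℝ) ^ ((d j : ℝ) / 2 - 1))

/-- The kernel moments `b_{d,j}(L) = λ_d(L(s) s_j) / (d_j λ_d(L))`. -/
def kernelMoment {r : ℕ} (d : Fin r → ℕ) (L : (Fin r → ℝ) → ℝ) : Fin r → ℝ :=
  fun j => lam d (fun s => L s * s j) / ((d j : ℝ) * lam d L)

end PolyKDE

end

namespace PolyKDE

/-! ### Polar coordinates for the lower integral. -/

section Polar

open Set Metric

variable {E : Type*} [NormedAddCommGroup E] [NormedSpace ℝ E] [MeasurableSpace E] [BorelSpace E]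
  [FiniteDimensional ℝ E] (μ : Measure E) [μ.IsAddHaarMeasure]

/-! The mean of the estimator is `∫ K f / ∫ K`, where `K(y)` is the unnormalized kernel at `x`. This
`K` depends on `y` only through the products `t_j = x_j'y_j`, so blockwise isometries fixing `x`
preserve it. Hence `f(y)` may be averaged with `f(y*)`, where `y*` is the reflection of `y` through
`x`. Split `y_j = t_j x_j + w_j` with `w_j` tangential. Since `f̄` is invariant under positive
scaling of each block, for `y` near `x` one has `f(y) = f̄(x + z)` and `f(y*) = f̄(x - z)` with `z_j
= w_j / t_j`. Odd Taylor terms cancel, and replacing `z` by `w` in the Hessian costs only the square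
of `∑ (1 - t_j)` (`RadialC4.exists_expansion`).

By the symmetry of `K`, the Hessian form in `w` integrates to `∑ tr(𝓗_jj) / d_j · ∫ K ‖w_j‖²`
(`integral_zonal_quadratic`). The full trace appears because the Hessian vanishes in the radial
directions. As `‖w_j‖² = 2(1 - t_j) - (1 - t_j)²`, what remains are the first moments of `1 - t_j`
under `K`, up to second moments (`RadialC4.exists_integral_expansion`).

Under the surface measure, `s_j = (1 - t_j) / h_j²` has density proportional to `h_j^{d_j}
s_j^{d_j/2-1} (2 - h_j² s_j)^{d_j/2-1}`. Constants and powers of `h` cancel in the ratio, so it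
remains to replace `2 - h_j² s_j` by `2` with error `O(∑ h_j²)`
(`IsKernel.exists_bandWeight_bound`). The difficulty is `d_j = 1`, where the weight blows up at `s_j
= 2 / h_j²`. Moments of `L` do not control that moving point, and boundedness of `L` is used there
(`mul_sq_le_split`). -/

theorem lintegral_volumeIoiPow (n : ℕ) {g : ℝ → ENNReal} (hg : Measurable g) :
    ∫⁻ ρ, g (ρ : ℝ) ∂(Measure.volumeIoiPow n) =
      ∫⁻ ρ in Ioi (0 : ℝ), ENNReal.ofReal (ρ ^ n) * g ρ := by
  rw [Measure.volumeIoiPow, lintegral_withDensity_eq_lintegral_mul _ (by fun_prop) (by fun_prop)]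
  exact lintegral_subtype_comap measurableSet_Ioi fun ρ : ℝ => ENNReal.ofReal (ρ ^ n) * g ρ

/-- Integration in polar coordinates, for nonnegative functions. -/
theorem lintegral_eq_lintegral_toSphere [Nontrivial E] {F : E → ENNReal} (hF : Measurable F) :
    ∫⁻ z, F z ∂μ = ∫⁻ y : sphere (0 : E) 1, ∫⁻ ρ in Ioi (0 : ℝ),
      ENNReal.ofReal (ρ ^ (Module.finrank ℝ E - 1)) * F (ρ • (y : E)) ∂volume ∂μ.toSphere := by
  have hm : Measurable fun p : sphere (0 : E) 1 × Ioi (0 : ℝ) => F ((p.2 : ℝ) • (p.1 : E)) := by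
    fun_prop
  calc ∫⁻ z, F z ∂μ = ∫⁻ z in ({0}ᶜ : Set E), F z ∂μ := by
        rw [restrict_compl_singleton]
    _ = ∫⁻ z : ({0}ᶜ : Set E), F z ∂(μ.comap (↑)) :=
        (lintegral_subtype_comap (measurableSet_singleton _).compl F).symm
    _ = ∫⁻ p, F ((p.2 : ℝ) • (p.1 : E))
          ∂(μ.toSphere.prod (Measure.volumeIoiPow (Module.finrank ℝ E - 1))) := by
        rw [← (Measure.measurePreserving_homeomorphUnitSphereProd μ).lintegral_comp hm]
        refine lintegral_congr fun z => ?_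
        have hz : ‖(z : E)‖ ≠ 0 := norm_ne_zero_iff.2 z.2
        simp [hz]
    _ = _ := by
        rw [lintegral_prod _ hm.aemeasurable]
        refine lintegral_congr fun y => ?_
        exact lintegral_volumeIoiPow _ (g := fun ρ : ℝ => F (ρ • (y : E))) (by fun_prop)

end Polar

/-! ### The law of one coordinate on the sphere. -/

section SphereLaw

open Set Metric Real

theorem lintegral_radial {d : ℕ} (hd : 1 ≤ d) {G : ℝ → ENNReal} (hG : Measurable G) :
    ∫⁻ w : EuclideanSpace ℝ (Fin d), G ‖w‖ =
      (volume : Measure (EuclideanSpace ℝ (Fin d))).toSphere univ *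
        ∫⁻ ρ in Ioi (0 : ℝ), ENNReal.ofReal (ρ ^ (d - 1)) * G ρ := by
  have : Nonempty (Fin d) := ⟨⟨0, hd⟩⟩
  rw [lintegral_eq_lintegral_toSphere _ (by fun_prop), mul_comm, ← lintegral_const]
  refine lintegral_congr fun y => ?_
  refine setLIntegral_congr_fun measurableSet_Ioi fun ρ hρ => ?_
  have hρ : 0 < ρ := hρ
  simp [norm_smul, abs_of_pos hρ]

/-- Split off the first coordinate by Fubini and use polar coordinates in the remaining `ℝ^d`. -/
theorem lintegral_pole_norm {d : ℕ} (hd : 1 ≤ d) {Φ : ℝ × ℝ → ENNReal} (hΦ : Measurable Φ) :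
    ∫⁻ z : Ambient d, Φ (z 0, ‖z‖) =
      (volume : Measure (EuclideanSpace ℝ (Fin d))).toSphere univ *
        ∫⁻ t : ℝ, ∫⁻ ρ in Ioi (0 : ℝ), ENNReal.ofReal (ρ ^ (d - 1)) * Φ (t, √(t ^ 2 + ρ ^ 2)) := by
  have h1 : ∫⁻ z : Ambient d, Φ (z 0, ‖z‖) =
      ∫⁻ z : Fin (d + 1) → ℝ, Φ (z 0, √(∑ i, z i ^ 2)) := by
    rw [← (PiLp.volume_preserving_ofLp (Fin (d + 1))).lintegral_comp (by fun_prop)]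
    refine lintegral_congr fun z => ?_
    simp [EuclideanSpace.norm_eq]
  have h2 : ∫⁻ z : Fin (d + 1) → ℝ, Φ (z 0, √(∑ i, z i ^ 2)) =
      ∫⁻ p : ℝ × (Fin d → ℝ), Φ (p.1, √(p.1 ^ 2 + ∑ i, p.2 i ^ 2)) := by
    have := (volume_preserving_piFinSuccAbove (fun _ : Fin (d + 1) => ℝ) 0)
    rw [← this.lintegral_comp (by fun_prop)]
    refine lintegral_congr fun z => ?_
    simp [MeasurableEquiv.piFinSuccAbove, Fin.insertNthEquiv, Fin.sum_univ_succ, Fin.tail]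
  rw [h1, h2, Measure.volume_eq_prod, lintegral_prod _ (by fun_prop), ← lintegral_const_mul']
  · refine lintegral_congr fun t => ?_
    rw [← lintegral_radial hd (G := fun ρ => Φ (t, √(t ^ 2 + ρ ^ 2))) (by fun_prop),
      ← (PiLp.volume_preserving_ofLp (Fin d)).lintegral_comp (by fun_prop)]
    refine lintegral_congr fun z => ?_
    rw [EuclideanSpace.real_norm_sq_eq]
  · exact measure_ne_top _ _

/-- The law of the first coordinate under the surface measure, in angular form. -/
theorem lintegral_surfaceMeasure_coord {d : ℕ} (hd : 1 ≤ d) {g : ℝ → ENNReal}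
    (hg : Measurable g) :
    ∫⁻ y : Sphere d, g ((y : Ambient d) 0) ∂(surfaceMeasure d) =
      (volume : Measure (EuclideanSpace ℝ (Fin d))).toSphere univ *
        ∫⁻ θ in Ioo 0 π, ENNReal.ofReal (sin θ ^ (d - 1)) * g (cos θ) := by
  set A : ENNReal := ∫⁻ ρ in Ioo (0 : ℝ) 1, ENNReal.ofReal (ρ ^ d) with hA
  have hA_val : A = ENNReal.ofReal (1 / (d + 1)) := by
    rw [hA, setLIntegral_congr Ioo_ae_eq_Ioc, ← ofReal_integral_eq_lintegral_ofReal]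
    · rw [← intervalIntegral.integral_of_le zero_le_one]; simp
    · exact (intervalIntegral.intervalIntegrable_pow d).1
    · filter_upwards [ae_restrict_mem measurableSet_Ioc] with y hy
      exact pow_nonneg hy.1.le _
  have hA0 : A ≠ 0 := by rw [hA_val]; simp; positivity
  have hAt : A ≠ ⊤ := by rw [hA_val]; simp
  -- The integral of `g (z 0 / ‖z‖)` over the unit ball is computed in two ways. Both contain the
  -- radial factor `A = 1 / (d + 1)`, which cancels because it is finite and nonzero.
  let Φ : ℝ × ℝ → ENNReal := fun p => (Iio (1 : ℝ)).indicator (fun _ => g (p.1 / p.2)) p.2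
  have hΦ : Measurable Φ := by
    have : Φ = (Prod.snd ⁻¹' (Iio (1 : ℝ))).indicator fun p : ℝ × ℝ => g (p.1 / p.2) := by
      ext p; simp [Φ, indicator]
    rw [this]
    exact Measurable.indicator (by fun_prop) (measurable_snd measurableSet_Iio)
  have key1 : ∫⁻ z : Ambient d, Φ (z 0, ‖z‖) =
      A * ∫⁻ y : Sphere d, g ((y : Ambient d) 0) ∂(surfaceMeasure d) := by
    rw [lintegral_eq_lintegral_toSphere _ (by fun_prop), ← lintegral_const_mul' _ _ hAt]
    refine lintegral_congr fun y => ?_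
    have : ∀ ρ ∈ Ioi (0 : ℝ), ENNReal.ofReal (ρ ^ (Module.finrank ℝ (Ambient d) - 1)) *
        Φ ((ρ • (y : Ambient d)) 0, ‖ρ • (y : Ambient d)‖) =
        (Iio (1 : ℝ)).indicator (fun ρ => ENNReal.ofReal (ρ ^ d) * g ((y : Ambient d) 0)) ρ := by
      intro ρ hρ
      have hρ : 0 < ρ := hρ
      by_cases h1 : ρ < 1
      · simp [Φ, norm_smul, abs_of_pos hρ, h1, hρ.ne']
      · simp [Φ, norm_smul, abs_of_pos hρ, h1]
    rw [setLIntegral_congr_fun measurableSet_Ioi this, lintegral_indicator measurableSet_Iio,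
      Measure.restrict_restrict measurableSet_Iio, inter_comm, Ioi_inter_Iio,
      lintegral_mul_const _ (by fun_prop)]
  -- Planar polar coordinates in the half plane `ρ > 0`, that is `0 < θ < π`. The Jacobian turns `(r
  -- sin θ) ^ (d - 1)` into `r ^ d * sin θ ^ (d - 1)`, so the variables separate.
  have key2 : ∫⁻ t : ℝ, ∫⁻ ρ in Ioi (0 : ℝ), ENNReal.ofReal (ρ ^ (d - 1)) *
      Φ (t, √(t ^ 2 + ρ ^ 2)) =
      A * ∫⁻ θ in Ioo 0 π, ENNReal.ofReal (sin θ ^ (d - 1)) * g (cos θ) := by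
    let f : ℝ × ℝ → ENNReal := fun p => (Ioi (0 : ℝ)).indicator
      (fun ρ => ENNReal.ofReal (ρ ^ (d - 1)) * Φ (p.1, √(p.1 ^ 2 + ρ ^ 2))) p.2
    have hf : Measurable f := by
      have : f = (Prod.snd ⁻¹' (Ioi (0 : ℝ))).indicator fun p : ℝ × ℝ =>
          ENNReal.ofReal (p.2 ^ (d - 1)) * Φ (p.1, √(p.1 ^ 2 + p.2 ^ 2)) := by
        ext p; simp [f, indicator]
      rw [this]
      exact Measurable.indicator (by fun_prop) (measurable_snd measurableSet_Ioi)
    have e1 : ∫⁻ t : ℝ, ∫⁻ ρ in Ioi (0 : ℝ), ENNReal.ofReal (ρ ^ (d - 1)) *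
        Φ (t, √(t ^ 2 + ρ ^ 2)) = ∫⁻ p : ℝ × ℝ, f p := by
      rw [Measure.volume_eq_prod, lintegral_prod _ hf.aemeasurable]
      refine lintegral_congr fun t => ?_
      exact (lintegral_indicator measurableSet_Ioi _).symm
    have hpt : ∀ p ∈ polarCoord.target, ENNReal.ofReal p.1 • f (polarCoord.symm p) =
        (Iio (1 : ℝ)).indicator (fun r => ENNReal.ofReal (r ^ d)) p.1 *
          (Ioi (0 : ℝ)).indicator (fun θ => ENNReal.ofReal (sin θ ^ (d - 1)) * g (cos θ)) p.2 := by
      rintro ⟨r, θ⟩ ⟨hr, hθ⟩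
      have hr : 0 < r := hr
      simp only [polarCoord_symm_apply, f]
      have hs : √((r * cos θ) ^ 2 + (r * sin θ) ^ 2) = r := by
        rw [show (r * cos θ) ^ 2 + (r * sin θ) ^ 2 = r ^ 2 * (sin θ ^ 2 + cos θ ^ 2) by ring,
          sin_sq_add_cos_sq, mul_one, sqrt_sq hr.le]
      by_cases h0 : 0 < θ
      · have hsin : 0 < sin θ := sin_pos_of_pos_of_lt_pi h0 hθ.2
        have : 0 < r * sin θ := mul_pos hr hsin
        by_cases h1 : r < 1
        · rw [indicator_of_mem (by exact this), indicator_of_mem (by exact h1),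
            indicator_of_mem (by exact h0), hs]
          simp only [Φ]
          rw [indicator_of_mem (by exact h1), mul_div_cancel_left₀ _ hr.ne', smul_eq_mul, mul_pow,
            ENNReal.ofReal_mul (by positivity), ← mul_assoc, ← mul_assoc,
            ← ENNReal.ofReal_mul hr.le, ← pow_succ', Nat.sub_add_cancel hd, mul_assoc]
        · simp [Φ, hs, h1, indicator]
      · have : sin θ ≤ 0 := sin_nonpos_of_nonpos_of_neg_pi_le (not_lt.1 h0) hθ.1.le
        have h2 : ¬ (0 < r * sin θ) := not_lt.2 (mul_nonpos_of_nonneg_of_nonpos hr.le this)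
        simp [h0, h2, indicator]
    have hm1 : Measurable fun r : ℝ =>
        (Iio (1 : ℝ)).indicator (fun r => ENNReal.ofReal (r ^ d)) r :=
      Measurable.indicator (by fun_prop) measurableSet_Iio
    have hm2 : Measurable fun θ : ℝ => (Ioi (0 : ℝ)).indicator
        (fun θ => ENNReal.ofReal (sin θ ^ (d - 1)) * g (cos θ)) θ :=
      Measurable.indicator (by fun_prop) measurableSet_Ioi
    rw [e1, ← lintegral_comp_polarCoord_symm,
      setLIntegral_congr_fun polarCoord.open_target.measurableSet hpt]
    have ht : polarCoord.target = Ioi (0 : ℝ) ×ˢ Ioo (-π) π := rfl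
    rw [ht, Measure.volume_eq_prod, ← Measure.prod_restrict,
      lintegral_prod_mul hm1.aemeasurable hm2.aemeasurable]
    congr 1
    · rw [lintegral_indicator measurableSet_Iio, Measure.restrict_restrict measurableSet_Iio,
        inter_comm, Ioi_inter_Iio]
    · rw [lintegral_indicator measurableSet_Ioi, Measure.restrict_restrict measurableSet_Ioi]
      congr 2
      ext θ
      simp only [mem_inter_iff, mem_Ioi, mem_Ioo]
      constructor
      · rintro ⟨h, _, h'⟩; exact ⟨h, h'⟩
      · rintro ⟨h, h'⟩; exact ⟨h, by linarith [pi_pos], h'⟩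
  rw [lintegral_pole_norm hd hΦ, key2, mul_left_comm] at key1
  exact ((ENNReal.mul_right_inj hA0 hAt).1 key1).symm

end SphereLaw

/-! ### Invariance of the surface measure under linear isometries. -/

section Invariance

open Set Metric Pointwise

/-- The action of a linear isometry on the unit sphere. -/
noncomputable def sphereMap {d : ℕ} (U : Ambient d ≃ₗᵢ[ℝ] Ambient d) (y : Sphere d) : Sphere d :=
  ⟨U y, by rw [mem_sphere_zero_iff_norm, U.norm_map]; exact norm_eq_of_mem_sphere y⟩

@[simp]
theorem coe_sphereMap {d : ℕ} (U : Ambient d ≃ₗᵢ[ℝ] Ambient d) (y : Sphere d) :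
    (sphereMap U y : Ambient d) = U y := rfl

theorem measurable_sphereMap {d : ℕ} (U : Ambient d ≃ₗᵢ[ℝ] Ambient d) :
    Measurable (sphereMap U) :=
  (U.continuous.measurable.comp measurable_subtype_coe).subtype_mk

instance {d : ℕ} : IsFiniteMeasure (surfaceMeasure d) := by
  unfold surfaceMeasure; infer_instance

instance {r : ℕ} {d : Fin r → ℕ} : IsFiniteMeasure (polyMeasure d) := by
  unfold polyMeasure; infer_instance

/-- The surface measure of a set is a multiple of the volume of the cone over it, and isometries
preserve volume. -/
theorem measurePreserving_sphereMap {d : ℕ} (U : Ambient d ≃ₗᵢ[ℝ] Ambient d) :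
    MeasurePreserving (sphereMap U) (surfaceMeasure d) (surfaceMeasure d) := by
  refine ⟨measurable_sphereMap U, ?_⟩
  ext s hs
  rw [Measure.map_apply (measurable_sphereMap U) hs]
  unfold surfaceMeasure
  rw [Measure.toSphere_apply' _ hs, Measure.toSphere_apply' _ (measurable_sphereMap U hs)]
  congr 1
  rw [← U.measurePreserving.measure_preimage_equiv (f := U.toHomeomorph.toMeasurableEquiv)
    (Ioo (0 : ℝ) 1 • (Subtype.val '' s))]
  congr 1
  ext z
  simp only [Set.mem_smul, mem_preimage]
  constructor
  · rintro ⟨ρ, hρ, _, ⟨y, hy, rfl⟩, rfl⟩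
    exact ⟨ρ, hρ, U y, ⟨sphereMap U y, hy, rfl⟩, (U.map_smul ρ _).symm⟩
  · rintro ⟨ρ, hρ, _, ⟨y, hy, rfl⟩, hz⟩
    have hz : ρ • (y : Ambient d) = U z := hz
    refine ⟨ρ, hρ, U.symm y, ⟨sphereMap U.symm y, ?_, rfl⟩, ?_⟩
    · have : sphereMap U (sphereMap U.symm y) = y := by ext1; simp
      rwa [mem_preimage, this]
    · change ρ • U.symm y = z
      rw [← map_smul, hz, U.symm_apply_apply]

/-- The blockwise action of linear isometries on the polysphere. -/
noncomputable def polyMap {r : ℕ} {d : Fin r → ℕ} (U : ∀ j, Ambient (d j) ≃ₗᵢ[ℝ] Ambient (d j))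
    (y : Polysphere d) : Polysphere d := fun j => sphereMap (U j) (y j)

theorem measurePreserving_polyMap {r : ℕ} {d : Fin r → ℕ}
    (U : ∀ j, Ambient (d j) ≃ₗᵢ[ℝ] Ambient (d j)) :
    MeasurePreserving (polyMap U) (polyMeasure d) (polyMeasure d) :=
  measurePreserving_pi _ _ fun j => measurePreserving_sphereMap (U j)

theorem exists_isometry_map_eq {d : ℕ} (x y : Sphere d) :
    ∃ U : Ambient d ≃ₗᵢ[ℝ] Ambient d, U x = y :=
  ⟨Submodule.reflection (ℝ ∙ ((x : Ambient d) - y))ᗮ, Submodule.reflection_sub (by simp)⟩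

end Invariance

/-! ### The joint law of the scaled deviations. -/

section Law

open Set Real

/-- The density factor of `(1 - x'y) / h²` under the surface measure. -/
noncomputable def bandWeight (d : ℕ) (h s : ℝ) : ℝ :=
  if h ^ 2 * s < 2 then s ^ ((d : ℝ) / 2 - 1) * (2 - h ^ 2 * s) ^ ((d : ℝ) / 2 - 1) else 0

theorem measurable_bandWeight (d : ℕ) (h : ℝ) : Measurable (bandWeight d h) := by
  unfold bandWeight
  exact Measurable.ite (measurableSet_lt (by fun_prop) (by fun_prop)) (by fun_prop) (by fun_prop)

theorem bandWeight_nonneg (d : ℕ) (h : ℝ) {s : ℝ} (hs : 0 ≤ s) : 0 ≤ bandWeight d h s := by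
  unfold bandWeight
  split_ifs with h1
  · exact mul_nonneg (rpow_nonneg hs _) (rpow_nonneg (by linarith) _)
  · exact le_rfl

/-- Substitute `s = (1 - cos θ) / h²`, so that `ds = sin θ dθ / h²` and `sin² θ = h² s (2 - h² s)`.
-/
theorem lintegral_angle_eq {d : ℕ} (hd : 1 ≤ d) {h : ℝ} (hh : 0 < h) {g : ℝ → ENNReal} :
    ∫⁻ θ in Ioo 0 π, ENNReal.ofReal (sin θ ^ (d - 1)) * g ((1 - cos θ) / h ^ 2) =
      ∫⁻ s in Ioi (0 : ℝ), ENNReal.ofReal (h ^ d * bandWeight d h s) * g s := by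
  have hh2 : 0 < h ^ 2 := by positivity
  have himg : (fun θ => (1 - cos θ) / h ^ 2) '' Ioo 0 π = Ioo 0 (2 / h ^ 2) := by
    ext s
    simp only [mem_image, mem_Ioo]
    constructor
    · rintro ⟨θ, ⟨h0, h1⟩, rfl⟩
      have a1 : cos θ < 1 := by
        simpa using cos_lt_cos_of_nonneg_of_le_pi le_rfl h1.le h0
      have a2 : -1 < cos θ := by
        simpa using cos_lt_cos_of_nonneg_of_le_pi h0.le le_rfl h1
      exact ⟨div_pos (by linarith) hh2, div_lt_div_of_pos_right (by linarith) hh2⟩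
    · rintro ⟨h0, h1⟩
      have h1' : s * h ^ 2 < 2 := (lt_div_iff₀ hh2).1 h1
      have h0' : 0 < s * h ^ 2 := by positivity
      refine ⟨arccos (1 - s * h ^ 2), ⟨arccos_pos.2 (by linarith), ?_⟩, ?_⟩
      · refine lt_of_le_of_ne (arccos_le_pi _) fun e => ?_
        rw [arccos_eq_pi] at e
        linarith
      · rw [cos_arccos (by linarith) (by linarith)]
        field_simp
        ring
  have hinj : InjOn (fun θ => (1 - cos θ) / h ^ 2) (Ioo 0 π) := by
    intro a ha b hb hab
    have : (1 - cos a) / h ^ 2 = (1 - cos b) / h ^ 2 := hab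
    rw [div_left_inj' hh2.ne'] at this
    exact injOn_cos ⟨ha.1.le, ha.2.le⟩ ⟨hb.1.le, hb.2.le⟩ (by linarith)
  have hder : ∀ θ ∈ Ioo 0 π, HasDerivWithinAt (fun θ => (1 - cos θ) / h ^ 2) (sin θ / h ^ 2)
      (Ioo 0 π) θ := by
    intro θ _
    have := ((hasDerivAt_cos θ).const_sub 1).div_const (h ^ 2)
    rw [neg_neg] at this
    exact this.hasDerivWithinAt
  have hcv := lintegral_image_eq_lintegral_abs_deriv_mul measurableSet_Ioo hder hinj
    (fun s => ENNReal.ofReal (h ^ d * bandWeight d h s) * g s)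
  rw [himg] at hcv
  have hR : ∫⁻ s in Ioi (0 : ℝ), ENNReal.ofReal (h ^ d * bandWeight d h s) * g s =
      ∫⁻ s in Ioo 0 (2 / h ^ 2), ENNReal.ofReal (h ^ d * bandWeight d h s) * g s := by
    rw [← Ioi_inter_Iio, inter_comm, ← Measure.restrict_restrict measurableSet_Iio,
      ← lintegral_indicator measurableSet_Iio]
    refine lintegral_congr fun s => ?_
    by_cases hs : s < 2 / h ^ 2
    · rw [indicator_of_mem (by exact hs)]
    · have : ¬ h ^ 2 * s < 2 := by rwa [mul_comm, ← lt_div_iff₀ hh2]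
      simp [bandWeight, hs, this]
  rw [hR, hcv]
  refine setLIntegral_congr_fun measurableSet_Ioo fun θ hθ => ?_
  have hs : 0 < sin θ := sin_pos_of_mem_Ioo hθ
  rw [← mul_assoc, ← ENNReal.ofReal_mul (abs_nonneg _)]
  congr 2
  have a1 : 0 < 1 - cos θ := by
    have := cos_lt_cos_of_nonneg_of_le_pi le_rfl hθ.2.le hθ.1
    simp at this; linarith
  have a2 : 0 < 1 + cos θ := by
    have := cos_lt_cos_of_nonneg_of_le_pi hθ.1.le le_rfl hθ.2
    simp at this; linarith
  have e1 : h ^ 2 * ((1 - cos θ) / h ^ 2) = 1 - cos θ := by field_simp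
  rw [bandWeight, e1, if_pos (by linarith), abs_of_pos (by positivity),
    show 2 - (1 - cos θ) = 1 + cos θ by ring, div_rpow a1.le hh2.le, div_mul_eq_mul_div,
    div_mul_eq_mul_div, ← mul_rpow a1.le a2.le, show (1 - cos θ) * (1 + cos θ) = sin θ ^ 2 by
      rw [sin_sq]; ring]
  have b (u : ℝ) (hu : 0 < u) : (u ^ 2) ^ ((d : ℝ) / 2 - 1) = u ^ d / u ^ 2 := by
    rw [← rpow_natCast u 2, ← rpow_mul hu.le, show ((2 : ℕ) : ℝ) * ((d : ℝ) / 2 - 1) = d - (2 : ℕ) by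
      push_cast; ring, rpow_sub hu, rpow_natCast, rpow_natCast]
  rw [b _ hs, b _ hh, show sin θ ^ d = sin θ ^ (d - 1) * sin θ by
    rw [← pow_succ, Nat.sub_add_cancel hd]]
  field_simp

/-- The law of `(1 - x'y) / h²` under the surface measure, up to a constant that depends only on the
dimension. -/
theorem exists_lintegral_scaled {d : ℕ} (hd : 1 ≤ d) :
    ∃ C : ℝ, 0 < C ∧ ∀ (x : Sphere d) (h : ℝ), 0 < h → ∀ g : ℝ → ENNReal, Measurable g →
      ∫⁻ y : Sphere d, g ((1 - inner ℝ (x : Ambient d) y) / h ^ 2) ∂(surfaceMeasure d) =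
        ∫⁻ s in Ioi (0 : ℝ), ENNReal.ofReal (C * h ^ d * bandWeight d h s) * g s := by
  have : Nonempty (Fin d) := ⟨⟨0, hd⟩⟩
  set σ := (volume : Measure (EuclideanSpace ℝ (Fin d))).toSphere univ with hσ
  have hσt : σ ≠ ⊤ := measure_ne_top _ _
  have hσ0 : σ ≠ 0 := by
    rw [hσ, Ne, Measure.measure_univ_eq_zero]
    exact Measure.toSphere_ne_zero _
  refine ⟨σ.toReal, ENNReal.toReal_pos hσ0 hσt, fun x h hh g hg => ?_⟩
  obtain ⟨U, hU⟩ := exists_isometry_map_eq (pole (fun _ : Fin 1 => d) 0) x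
  have e1 : ∫⁻ y : Sphere d, g ((1 - inner ℝ (x : Ambient d) y) / h ^ 2) ∂(surfaceMeasure d) =
      ∫⁻ y : Sphere d, g ((1 - (y : Ambient d) 0) / h ^ 2) ∂(surfaceMeasure d) := by
    rw [← (measurePreserving_sphereMap U).lintegral_comp (by fun_prop)]
    refine lintegral_congr fun y => ?_
    rw [coe_sphereMap, ← hU, U.inner_map_map]
    simp [pole, EuclideanSpace.inner_single_left]
  rw [e1, lintegral_surfaceMeasure_coord hd (g := fun t => g ((1 - t) / h ^ 2)) (by fun_prop),
    lintegral_angle_eq hd hh, ← hσ, ← lintegral_const_mul' _ _ hσt]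
  refine lintegral_congr fun s => ?_
  rw [← mul_assoc, mul_assoc _ (h ^ d), ENNReal.ofReal_mul ENNReal.toReal_nonneg,
    ENNReal.ofReal_toReal hσt]

/-- Both measures agree on boxes, by Fubini for products of integrable functions. -/
theorem pi_withDensity_ofReal {ι : Type*} [Fintype ι] {μ : ι → Measure ℝ} [∀ i, SigmaFinite (μ i)]
    {φ : ι → ℝ → ℝ} (hφ : ∀ i, Integrable (φ i) (μ i)) (h0 : ∀ i, 0 ≤ᵐ[μ i] φ i)
    [∀ i, SigmaFinite ((μ i).withDensity fun s => ENNReal.ofReal (φ i s))] :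
    Measure.pi (fun i => (μ i).withDensity fun s => ENNReal.ofReal (φ i s)) =
      (Measure.pi μ).withDensity fun s => ENNReal.ofReal (∏ i, φ i (s i)) := by
  refine Measure.pi_eq fun s hs => ?_
  have hnn : ∀ᵐ z ∂(Measure.pi μ), ∀ i, 0 ≤ φ i (z i) :=
    eventually_all.2 fun i => (Measure.tendsto_eval_ae_ae (i := i)).eventually (h0 i)
  rw [withDensity_apply _ (MeasurableSet.univ_pi hs), ← ofReal_integral_eq_lintegral_ofReal
      (Integrable.fintype_prod hφ).restrict
      (ae_restrict_of_ae (hnn.mono fun z hz => Finset.prod_nonneg fun i _ => hz i)),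
    Measure.restrict_pi_pi, integral_fintype_prod_eq_prod,
    ENNReal.ofReal_prod_of_nonneg
      fun i _ => integral_nonneg_of_ae (ae_restrict_of_ae (h0 i))]
  refine Finset.prod_congr rfl fun i _ => ?_
  rw [withDensity_apply _ (hs i), ← ofReal_integral_eq_lintegral_ofReal
    (hφ i).restrict (ae_restrict_of_ae (h0 i))]

theorem posOrthant_eq_pi (r : ℕ) : posOrthant r = univ.pi fun _ => Ioi (0 : ℝ) := by
  ext s; simp [posOrthant]

theorem measurableSet_posOrthant (r : ℕ) : MeasurableSet (posOrthant r) := by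
  rw [posOrthant_eq_pi]; exact MeasurableSet.univ_pi fun _ => measurableSet_Ioi

theorem volume_restrict_posOrthant (r : ℕ) :
    (volume : Measure (Fin r → ℝ)).restrict (posOrthant r) =
      Measure.pi fun _ => (volume : Measure ℝ).restrict (Ioi 0) := by
  rw [posOrthant_eq_pi, volume_pi, Measure.restrict_pi_pi]

/-- Integration of a function of the scaled variables `(1 - x_j'y_j) / h_j²`. -/
theorem exists_integral_polyMeasure_scaled {r : ℕ} {d : Fin r → ℕ} (hd : ∀ j, 1 ≤ d j) :
    ∃ C : ℝ, 0 < C ∧ ∀ (x : Polysphere d) (h : Fin r → ℝ), (∀ j, 0 < h j) →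
      ∀ Ψ : (Fin r → ℝ) → ℝ, Measurable Ψ →
        ∫ y, Ψ (fun j => (1 - inner ℝ (x j : Ambient (d j)) (y j)) / h j ^ 2) ∂(polyMeasure d) =
          C * rho d h * ∫ s in posOrthant r, Ψ s * ∏ j, bandWeight (d j) (h j) (s j) := by
  choose C hC hlaw using fun j => exists_lintegral_scaled (hd j)
  refine ⟨∏ j, C j, Finset.prod_pos fun j _ => hC j, fun x h hh Ψ hΨ => ?_⟩
  let φ : Fin r → ℝ → ℝ := fun j s => C j * h j ^ d j * bandWeight (d j) (h j) s
  have hφm : ∀ j, Measurable (φ j) := fun j => (measurable_bandWeight _ _).const_mul _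
  have hCh : ∀ j, 0 < C j * h j ^ d j := fun j => mul_pos (hC j) (pow_pos (hh j) _)
  have hφ0 : ∀ j, 0 ≤ᵐ[volume.restrict (Ioi (0 : ℝ))] φ j := fun j => by
    filter_upwards [ae_restrict_mem measurableSet_Ioi] with s hs
    exact mul_nonneg (hCh j).le (bandWeight_nonneg _ _ (le_of_lt hs))
  let T : ∀ j, Sphere (d j) → ℝ := fun j y => (1 - inner ℝ (x j : Ambient (d j)) y) / h j ^ 2
  have hT : ∀ j, Measurable (T j) := fun j => by fun_prop
  have hmap : ∀ j, (surfaceMeasure (d j)).map (T j) =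
      (volume.restrict (Ioi (0 : ℝ))).withDensity fun s => ENNReal.ofReal (φ j s) := by
    intro j
    ext s hs
    rw [← lintegral_indicator_one hs, lintegral_map (measurable_one.indicator hs) (hT j),
      hlaw j (x j) (h j) (hh j) _ (measurable_one.indicator hs), withDensity_apply _ hs,
      ← lintegral_indicator hs]
    refine lintegral_congr fun t => ?_
    by_cases ht : t ∈ s <;> simp [ht, φ]
  have hfin : ∀ j, IsFiniteMeasure
      ((volume.restrict (Ioi (0 : ℝ))).withDensity fun s => ENNReal.ofReal (φ j s)) := fun j => by
    rw [← hmap j]; infer_instance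
  -- The weight needs no direct estimate: its integral is the total mass of a pushforward of a
  -- finite measure.
  have hφi : ∀ j, Integrable (φ j) (volume.restrict (Ioi (0 : ℝ))) := fun j => by
    refine ⟨(hφm j).aestronglyMeasurable, ?_⟩
    rw [hasFiniteIntegral_iff_ofReal (hφ0 j)]
    have := (hfin j).measure_univ_lt_top
    rwa [withDensity_apply _ MeasurableSet.univ, Measure.restrict_univ] at this
  have hpi : (polyMeasure d).map (fun y j => T j (y j)) =
      (volume.restrict (posOrthant r)).withDensity
        fun s => ENNReal.ofReal (∏ j, φ j (s j)) := by
    rw [polyMeasure, Measure.pi_map_pi fun j => (hT j).aemeasurable]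
    simp_rw [hmap]
    rw [pi_withDensity_ofReal hφi hφ0, volume_restrict_posOrthant]
  have hTm : Measurable fun (y : Polysphere d) j => T j (y j) :=
    measurable_pi_lambda _ fun j => (hT j).comp (measurable_pi_apply j)
  calc ∫ y, Ψ (fun j => (1 - inner ℝ (x j : Ambient (d j)) (y j)) / h j ^ 2) ∂(polyMeasure d)
      = ∫ s, Ψ s ∂((polyMeasure d).map (fun y j => T j (y j))) :=
        (integral_map hTm.aemeasurable hΨ.aestronglyMeasurable).symm
    _ = ∫ s in posOrthant r, (∏ j, φ j (s j)) * Ψ s := by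
        rw [hpi, integral_withDensity_eq_integral_toReal_smul (by fun_prop)
          (Eventually.of_forall fun _ => ENNReal.ofReal_lt_top)]
        refine setIntegral_congr_fun (measurableSet_posOrthant r) fun s hs => ?_
        simp only [smul_eq_mul]
        rw [ENNReal.toReal_ofReal (Finset.prod_nonneg fun j _ =>
          mul_nonneg (hCh j).le (bandWeight_nonneg _ _ (hs j).le))]
    _ = _ := by
        rw [← integral_const_mul]
        refine integral_congr_ae (Eventually.of_forall fun s => ?_)
        simp only [φ, rho, Finset.prod_mul_distrib]
        ring

end Law

/-! ### Second moments of the tangential component under a zonal function. -/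

section Symmetry

variable {r : ℕ} {d : Fin r → ℕ}

/-- The tangential component of `y` at `x`, block by block. -/
noncomputable def tangent (x y : Polysphere d) : ∀ j, Ambient (d j) :=
  fun j => (y j : Ambient (d j)) - inner ℝ (x j : Ambient (d j)) (y j) • (x j : Ambient (d j))

theorem continuous_tangent (x : Polysphere d) : Continuous (tangent x) := by
  unfold tangent
  fun_prop

theorem inner_self_sphere {n : ℕ} (x : Sphere n) : inner ℝ (x : Ambient n) (x : Ambient n) = 1 := by
  rw [real_inner_self_eq_norm_sq, norm_eq_of_mem_sphere, one_pow]

theorem inner_tangent (x y : Polysphere d) (j : Fin r) :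
    inner ℝ (x j : Ambient (d j)) (tangent x y j) = 0 := by
  simp only [tangent]
  rw [inner_sub_right, inner_smul_right, inner_self_sphere, mul_one, sub_self]

theorem norm_tangent_sq (x y : Polysphere d) (j : Fin r) :
    ‖tangent x y j‖ ^ 2 = 1 - inner ℝ (x j : Ambient (d j)) (y j) ^ 2 := by
  simp only [tangent]
  rw [norm_sub_sq_real, norm_smul, norm_eq_of_mem_sphere, norm_eq_of_mem_sphere, inner_smul_right,
    real_inner_comm, Real.norm_eq_abs, mul_one, sq_abs]
  ring

theorem tangent_polyMap {x : Polysphere d} {U : ∀ j, Ambient (d j) ≃ₗᵢ[ℝ] Ambient (d j)}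
    (hU : ∀ j, U j (x j) = x j) (y : Polysphere d) (j : Fin r) :
    tangent x (polyMap U y) j = U j (tangent x y j) := by
  have : inner ℝ (x j : Ambient (d j)) (U j (y j)) = inner ℝ (x j : Ambient (d j)) (y j) := by
    conv_lhs => rw [← hU j]
    exact (U j).inner_map_map _ _
  simp only [tangent, polyMap, coe_sphereMap, map_sub, map_smul, this, hU]

theorem integral_comp_polyMap (U : ∀ j, Ambient (d j) ≃ₗᵢ[ℝ] Ambient (d j))
    {F : Polysphere d → ℝ} (hF : AEStronglyMeasurable F (polyMeasure d)) :
    ∫ y, F (polyMap U y) ∂(polyMeasure d) = ∫ y, F y ∂(polyMeasure d) := by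
  have h := measurePreserving_polyMap U
  conv_rhs => rw [← h.map_eq]
  exact (integral_map h.measurable.aemeasurable (by rwa [h.map_eq])).symm

theorem integrable_mul_continuous {K φ : Polysphere d → ℝ} (hK : Integrable K (polyMeasure d))
    (hφ : Continuous φ) : Integrable (fun y => K y * φ y) (polyMeasure d) := by
  obtain ⟨M, hM⟩ := isCompact_univ.exists_bound_of_continuousOn hφ.continuousOn
  exact hK.mul_bdd hφ.aestronglyMeasurable (Eventually.of_forall fun y => hM y trivial)

/-- Invariance of a function under the stabilizer of `x`. -/
def IsZonal (x : Polysphere d) (K : Polysphere d → ℝ) : Prop :=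
  ∀ U : ∀ j, Ambient (d j) ≃ₗᵢ[ℝ] Ambient (d j), (∀ j, U j (x j) = x j) →
    ∀ y, K (polyMap U y) = K y

theorem IsZonal.integral_mul_comp {x : Polysphere d} {K : Polysphere d → ℝ} (hz : IsZonal x K)
    (hK : Integrable K (polyMeasure d)) {U : ∀ j, Ambient (d j) ≃ₗᵢ[ℝ] Ambient (d j)}
    (hU : ∀ j, U j (x j) = x j) {φ : Polysphere d → ℝ} (hφ : Continuous φ) :
    ∫ y, K y * φ (polyMap U y) ∂(polyMeasure d) = ∫ y, K y * φ y ∂(polyMeasure d) := by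
  rw [← integral_comp_polyMap U (integrable_mul_continuous hK hφ).aestronglyMeasurable]
  simp_rw [hz U hU]

/-- The isometry that acts as `V` on the block `j` and trivially on the others. -/
noncomputable def blockMap (j : Fin r) (V : Ambient (d j) ≃ₗᵢ[ℝ] Ambient (d j)) :
    ∀ k, Ambient (d k) ≃ₗᵢ[ℝ] Ambient (d k) :=
  Function.update (fun _ => LinearIsometryEquiv.refl ℝ _) j V

theorem blockMap_fix {x : Polysphere d} {j : Fin r} {V : Ambient (d j) ≃ₗᵢ[ℝ] Ambient (d j)}
    (hV : V (x j) = x j) (k : Fin r) : blockMap j V k (x k) = x k := by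
  by_cases h : k = j
  · subst h; simpa [blockMap] using hV
  · simp [blockMap, h]

theorem tangent_blockMap_same {x : Polysphere d} {j : Fin r}
    {V : Ambient (d j) ≃ₗᵢ[ℝ] Ambient (d j)} (hV : V (x j) = x j) (y : Polysphere d) :
    tangent x (polyMap (blockMap j V) y) j = V (tangent x y j) := by
  rw [tangent_polyMap (blockMap_fix hV)]
  simp [blockMap]

theorem tangent_blockMap_ne {x : Polysphere d} {j k : Fin r} (hjk : k ≠ j)
    {V : Ambient (d j) ≃ₗᵢ[ℝ] Ambient (d j)} (hV : V (x j) = x j) (y : Polysphere d) :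
    tangent x (polyMap (blockMap j V) y) k = tangent x y k := by
  rw [tangent_polyMap (blockMap_fix hV)]
  simp [blockMap, hjk]

/-- The reflection through the line of `u`. At `u = x_j` it reverses tangent vectors, which kills
the mixed block terms here and the odd Taylor terms later. -/
theorem exists_isometry_neg_orthogonal {E : Type*} [NormedAddCommGroup E] [InnerProductSpace ℝ E]
    (u : E) : ∃ V : E ≃ₗᵢ[ℝ] E, V u = u ∧ ∀ w, inner ℝ u w = 0 → V w = -w :=
  ⟨(ℝ ∙ u).reflection,
    Submodule.reflection_mem_subspace_eq_self (Submodule.mem_span_singleton_self _),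
    fun _ hw => Submodule.reflection_mem_subspace_orthogonalComplement_eq_neg
      (Submodule.mem_orthogonal_singleton_iff_inner_right.2 hw)⟩

/-- Used to kill the mixed moments of two coordinates within a block. -/
theorem exists_isometry_neg {E : Type*} [NormedAddCommGroup E] [InnerProductSpace ℝ E]
    (u : E) : ∃ V : E ≃ₗᵢ[ℝ] E, V u = -u ∧ ∀ w, inner ℝ u w = 0 → V w = w :=
  ⟨(ℝ ∙ u)ᗮ.reflection, Submodule.reflection_orthogonalComplement_singleton_eq_neg _,
    fun _ hw => Submodule.reflection_mem_subspace_eq_self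
      (Submodule.mem_orthogonal_singleton_iff_inner_right.2 hw)⟩

/-- Used to show that all tangential directions of a block have the same second moment. -/
theorem exists_isometry_swap {E : Type*} [NormedAddCommGroup E] [InnerProductSpace ℝ E]
    {u v : E} (h : ‖u‖ = ‖v‖) :
    ∃ V : E ≃ₗᵢ[ℝ] E, V u = v ∧ ∀ w, inner ℝ u w = 0 → inner ℝ v w = 0 → V w = w :=
  ⟨(ℝ ∙ (u - v))ᗮ.reflection, Submodule.reflection_sub h,
    fun _ hu hv => Submodule.reflection_mem_subspace_eq_self
      (Submodule.mem_orthogonal_singleton_iff_inner_right.2 (by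
        rw [inner_sub_left, hu, hv, sub_zero]))⟩

/-- Reversing the tangent vector in block `j` alone changes the sign of the integrand, so the
integral equals its own negative. -/
theorem integral_offDiagonal {x : Polysphere d} {K : Polysphere d → ℝ} (hz : IsZonal x K)
    (hK : Integrable K (polyMeasure d)) {j k : Fin r} (hjk : j ≠ k)
    (b : Ambient (d j) →L[ℝ] Ambient (d k) →L[ℝ] ℝ) :
    ∫ y, K y * b (tangent x y j) (tangent x y k) ∂(polyMeasure d) = 0 := by
  obtain ⟨V, hV, hVn⟩ := exists_isometry_neg_orthogonal (x j : Ambient (d j))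
  have hcont : Continuous fun y => b (tangent x y j) (tangent x y k) := by
    have := continuous_tangent x
    fun_prop
  have h := hz.integral_mul_comp hK (blockMap_fix hV) hcont
  have e : ∀ y, b (tangent x (polyMap (blockMap j V) y) j)
      (tangent x (polyMap (blockMap j V) y) k) = - b (tangent x y j) (tangent x y k) := by
    intro y
    rw [tangent_blockMap_same hV, tangent_blockMap_ne hjk.symm hV, hVn _ (inner_tangent x y j)]
    simp
  simp_rw [e, mul_neg, integral_neg] at h
  linarith

/-- The trace does not depend on the orthonormal basis. This moves from a basis adapted to `x_j` to
the coordinate basis of the Hessian block. -/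
theorem sum_bilin_orthonormalBasis {E ι κ : Type*} [NormedAddCommGroup E] [InnerProductSpace ℝ E]
    [Fintype ι] [Fintype κ] (c : OrthonormalBasis ι ℝ E) (e : OrthonormalBasis κ ℝ E)
    (b : E →L[ℝ] E →L[ℝ] ℝ) : ∑ i, b (e i) (e i) = ∑ a, b (c a) (c a) := by
  classical
  have h1 : ∀ i, b (e i) (e i) =
      ∑ a, ∑ a', inner ℝ (c a) (e i) * inner ℝ (e i) (c a') * b (c a) (c a') := by
    intro i
    conv_lhs => rw [← c.sum_repr' (e i)]
    simp only [map_sum, map_smul, _root_.sum_apply, _root_.smul_apply,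
      smul_eq_mul, Finset.mul_sum]
    rw [Finset.sum_comm]
    refine Finset.sum_congr rfl fun a _ => Finset.sum_congr rfl fun a' _ => ?_
    rw [real_inner_comm (c a') (e i)]
    ring
  simp_rw [h1]
  rw [Finset.sum_comm]
  refine Finset.sum_congr rfl fun a _ => ?_
  rw [Finset.sum_comm]
  simp_rw [← Finset.sum_mul, e.sum_inner_mul_inner, c.inner_eq_ite]
  simp

/-- By isotropy, the second moment matrix of the tangential component is a multiple of the
projection onto the orthogonal complement of `x_j`. That space has dimension `d j`, whence the
divisor. Pairing with `b` gives its trace over this complement, which by `hb` is the full trace. -/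
theorem integral_diagonal {x : Polysphere d} {K : Polysphere d → ℝ} (hz : IsZonal x K)
    (hK : Integrable K (polyMeasure d)) (j : Fin r) (hd : 1 ≤ d j)
    (b : Ambient (d j) →L[ℝ] Ambient (d j) →L[ℝ] ℝ) (hb : b (x j) (x j) = 0) :
    ∫ y, K y * b (tangent x y j) (tangent x y j) ∂(polyMeasure d) =
      (∑ a, b (EuclideanSpace.single a 1) (EuclideanSpace.single a 1)) / d j *
        ∫ y, K y * ‖tangent x y j‖ ^ 2 ∂(polyMeasure d) := by
  have hct := continuous_tangent x
  obtain ⟨c, hc⟩ : ∃ c : OrthonormalBasis (Fin (d j + 1)) ℝ (Ambient (d j)), c 0 = x j := by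
    have hv : Orthonormal ℝ (Set.domRestrict ({0} : Set (Fin (d j + 1)))
        fun _ => (x j : Ambient (d j))) := by
      refine ⟨fun _ => norm_eq_of_mem_sphere _, fun a a' h => ?_⟩
      exact absurd (Subsingleton.elim a a') h
    obtain ⟨c, hc⟩ := hv.exists_orthonormalBasis_extension_of_card_eq (by simp)
    exact ⟨c, hc 0 rfl⟩
  set m : Fin (d j + 1) → Fin (d j + 1) → ℝ := fun a a' =>
    ∫ y, K y * (inner ℝ (c a) (tangent x y j) * inner ℝ (c a') (tangent x y j)) ∂(polyMeasure d)
    with hm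
  have hcont : ∀ a a', Continuous fun y =>
      inner ℝ (c a) (tangent x y j) * inner ℝ (c a') (tangent x y j) := fun a a' => by fun_prop
  have h0 : ∀ y, inner ℝ (c 0) (tangent x y j) = 0 := fun y => by rw [hc]; exact inner_tangent x y j
  -- Flip the sign of the direction `c a` alone. For `a ≠ 0` this fixes `x_j = c 0`, and for `a = 0`
  -- the coordinate is identically zero.
  have hoff : ∀ a a', a ≠ a' → m a a' = 0 := by
    intro a a' h
    by_cases ha : a = 0
    · subst ha; simp [hm, h0]
    obtain ⟨V, hVa, hV⟩ := exists_isometry_neg (c a)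
    have hVx : V (x j) = x j := by
      rw [← hc]; exact hV _ (c.orthonormal.2 ha)
    have hh := hz.integral_mul_comp hK (blockMap_fix hVx) (hcont a a')
    have e : ∀ w, inner ℝ (c a) (V w) = - inner ℝ (c a) w := fun w => by
      rw [← inner_neg_left, ← V.inner_map_map (-c a) w, map_neg, hVa, neg_neg]
    have e' : ∀ w, inner ℝ (c a') (V w) = inner ℝ (c a') w := fun w => by
      rw [← V.inner_map_map (c a') w, hV _ (c.orthonormal.2 h)]
    simp_rw [tangent_blockMap_same hVx, e, e', neg_mul, mul_neg, integral_neg] at hh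
    change - m a a' = m a a' at hh
    linarith
  have hdiag : ∀ a a', a ≠ 0 → a' ≠ 0 → m a a = m a' a' := by
    intro a a' ha ha'
    obtain ⟨V, hVa, hV⟩ := exists_isometry_swap (u := c a) (v := c a') (by simp)
    have hVx : V (x j) = x j := by
      rw [← hc]; exact hV _ (c.orthonormal.2 ha) (c.orthonormal.2 ha')
    have e : ∀ w, inner ℝ (c a') (V w) = inner ℝ (c a) w := fun w => by
      rw [← V.inner_map_map (c a) w, hVa]
    have hh := hz.integral_mul_comp hK (blockMap_fix hVx) (hcont a' a')
    simp_rw [tangent_blockMap_same hVx, e] at hh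
    exact hh
  set M := ∫ y, K y * ‖tangent x y j‖ ^ 2 ∂(polyMeasure d) with hM
  have hsum : ∑ a, m a a = M := by
    refine (integral_finsetSum _ fun a _ =>
      integrable_mul_continuous hK (hcont a a)).symm.trans ?_
    refine integral_congr_ae (Eventually.of_forall fun y => ?_)
    simp only
    rw [← Finset.mul_sum, ← c.sum_sq_norm_inner_right (tangent x y j)]
    congr 1
    refine Finset.sum_congr rfl fun a _ => ?_
    rw [Real.norm_eq_abs, sq_abs, sq]
  have hm0 : m 0 0 = 0 := by simp [hm, h0]
  -- The `d j` nonradial moments coincide and add up to `M`.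
  have hval : ∀ a, a ≠ 0 → m a a = M / d j := by
    intro a ha
    rw [← hsum, Fin.sum_univ_succ, hm0, zero_add,
      Finset.sum_congr rfl fun i _ => hdiag i.succ a (Fin.succ_ne_zero i) ha, Finset.sum_const,
      Finset.card_univ, Fintype.card_fin, nsmul_eq_mul, mul_div_cancel_left₀]
    exact Nat.cast_ne_zero.2 (by omega)
  have hexp : ∀ y, K y * b (tangent x y j) (tangent x y j) = ∑ a, ∑ a', b (c a) (c a') *
      (K y * (inner ℝ (c a) (tangent x y j) * inner ℝ (c a') (tangent x y j))) := by
    intro y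
    conv_lhs => rw [← c.sum_repr' (tangent x y j)]
    simp only [map_sum, map_smul, _root_.sum_apply, _root_.smul_apply,
      smul_eq_mul, Finset.mul_sum]
    rw [Finset.sum_comm]
    refine Finset.sum_congr rfl fun a _ => Finset.sum_congr rfl fun a' _ => ?_
    ring
  have hint : ∀ a a', Integrable (fun y => b (c a) (c a') *
      (K y * (inner ℝ (c a) (tangent x y j) * inner ℝ (c a') (tangent x y j)))) (polyMeasure d) :=
    fun a a' => (integrable_mul_continuous hK (hcont a a')).const_mul _
  simp_rw [hexp]
  rw [integral_finsetSum _ fun a _ => integrable_finsetSum _ fun a' _ => hint a a']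
  have h2 : ∀ a, ∫ y, ∑ a', b (c a) (c a') *
      (K y * (inner ℝ (c a) (tangent x y j) * inner ℝ (c a') (tangent x y j))) ∂(polyMeasure d) =
      b (c a) (c a) * (M / d j) := by
    intro a
    rw [integral_finsetSum _ fun a' _ => hint a a']
    simp_rw [integral_const_mul]
    rw [Finset.sum_eq_single a (fun a' _ h => ?_) (by simp)]
    · by_cases ha : a = 0
      · subst ha; rw [hc, hb, zero_mul, zero_mul]
      · rw [← hval a ha]
    · change _ * m a a' = 0
      rw [hoff a a' (Ne.symm h), mul_zero]
  simp_rw [h2, ← Finset.sum_mul]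
  have := sum_bilin_orthonormalBasis c (EuclideanSpace.basisFun (Fin (d j + 1)) ℝ) b
  simp only [EuclideanSpace.basisFun_apply] at this
  rw [this]
  ring

/-- The integral of a quadratic form in the tangential component against a zonal function. -/
theorem integral_zonal_quadratic {x : Polysphere d} {K : Polysphere d → ℝ} (hz : IsZonal x K)
    (hK : Integrable K (polyMeasure d)) (hd : ∀ j, 1 ≤ d j)
    (B : (∀ j, Ambient (d j)) →L[ℝ] (∀ j, Ambient (d j)) →L[ℝ] ℝ)
    (hB : ∀ j, B (Pi.single j (x j : Ambient (d j))) (Pi.single j (x j : Ambient (d j))) = 0) :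
    ∫ y, K y * B (tangent x y) (tangent x y) ∂(polyMeasure d) =
      ∑ j, (∑ a, B (blockBasis d j a) (blockBasis d j a)) / d j *
        ∫ y, K y * ‖tangent x y j‖ ^ 2 ∂(polyMeasure d) := by
  let b : ∀ j k, Ambient (d j) →L[ℝ] Ambient (d k) →L[ℝ] ℝ := fun j k =>
    B.bilinearComp (ContinuousLinearMap.single ℝ (fun i => Ambient (d i)) j)
      (ContinuousLinearMap.single ℝ (fun i => Ambient (d i)) k)
  have hb : ∀ j k u v, b j k u v = B (Pi.single j u) (Pi.single k v) := fun j k u v => rfl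
  have hct := continuous_tangent x
  have hint : ∀ j k, Integrable (fun y => K y * b j k (tangent x y j) (tangent x y k))
      (polyMeasure d) := fun j k => integrable_mul_continuous hK (by fun_prop)
  have hexp : ∀ y, K y * B (tangent x y) (tangent x y) =
      ∑ j, ∑ k, K y * b j k (tangent x y j) (tangent x y k) := by
    intro y
    conv_lhs => rw [← Finset.univ_sum_single (tangent x y)]
    simp only [map_sum, _root_.sum_apply, Finset.mul_sum, hb]
    rw [Finset.sum_comm]
  simp_rw [hexp]
  rw [integral_finsetSum _ fun j _ => integrable_finsetSum _ fun k _ => hint j k]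
  refine Finset.sum_congr rfl fun j _ => ?_
  rw [integral_finsetSum _ fun k _ => hint j k, Finset.sum_eq_single j
    (fun k _ h => integral_offDiagonal hz hK (Ne.symm h) (b j k)) (by simp)]
  exact integral_diagonal hz hK j (hd j) (b j j) (hB j)

end Symmetry

/-! ### Symmetrized Taylor expansion. -/

section Taylor

/-- The even part of the fourth order Taylor expansion. -/
theorem exists_even_taylor_bound {E : Type*} [NormedAddCommGroup E] [NormedSpace ℝ E]
    {g : E → ℝ} {x : E} (hg : ContDiffAt ℝ 4 g x) :
    ∃ δ > 0, ∃ C, 0 ≤ C ∧ ∀ z : E, ‖z‖ < δ →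
      |g (x + z) + g (x - z) - 2 * g x - fderiv ℝ (fderiv ℝ g) x z z| ≤ C * ‖z‖ ^ 4 := by
  have h1 : ∀ᶠ y in nhds x, ContDiffAt ℝ 4 g y := hg.eventually (by simp)
  -- Continuity of the fourth derivative gives a uniform bound on a small ball, hence for the
  -- integral remainder along every segment from `x` inside it.
  have h2 : ∀ᶠ y in nhds x, ‖iteratedFDeriv ℝ 4 g y‖ < ‖iteratedFDeriv ℝ 4 g x‖ + 1 :=
    (hg.continuousAt_iteratedFDeriv le_rfl).norm.eventually (gt_mem_nhds (by linarith))
  obtain ⟨δ, hδ, hball⟩ := Metric.eventually_nhds_iff_ball.1 (h1.and h2)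
  set M := ‖iteratedFDeriv ℝ 4 g x‖ + 1 with hM
  have hM0 : 0 ≤ M := by positivity
  have key : ∀ z : E, ‖z‖ < δ →
      |g (x + z) - ∑ k ∈ Finset.range 4, ((k.factorial : ℝ))⁻¹ *
        iteratedFDeriv ℝ k g x (fun _ => z)| ≤ M * ‖z‖ ^ 4 := by
    intro z hz
    have hmem : ∀ t ∈ Set.Icc (0 : ℝ) 1, x + t • z ∈ Metric.ball x δ := by
      intro t ht
      rw [Metric.mem_ball, dist_eq_norm, add_sub_cancel_left, norm_smul, Real.norm_eq_abs,
        abs_of_nonneg ht.1]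
      exact (mul_le_of_le_one_left (norm_nonneg _) ht.2).trans_lt hz
    have ht := map_add_eq_sum_add_integral_iteratedFDeriv (n := 3) (f := g) (x := x) (y := z)
      (fun t ht => by
        have := (hball _ (hmem t ht)).1
        norm_num
        exact this)
    rw [ht]
    simp only [smul_eq_mul, add_sub_cancel_left]
    rw [abs_mul]
    have hI : ‖∫ t in (0 : ℝ)..1, (1 - t) ^ 3 * iteratedFDeriv ℝ (3 + 1) g (x + t • z) fun _ => z‖
        ≤ (M * ‖z‖ ^ 4) * |(1 : ℝ) - 0| := by
      refine intervalIntegral.norm_integral_le_of_norm_le_const fun t ht => ?_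
      rw [Set.uIoc_of_le zero_le_one] at ht
      have h4 := (hball _ (hmem t ⟨ht.1.le, ht.2⟩)).2.le
      have h5 : ‖iteratedFDeriv ℝ (3 + 1) g (x + t • z) fun _ => z‖ ≤ M * ‖z‖ ^ 4 := by
        refine (ContinuousMultilinearMap.le_opNorm _ _).trans ?_
        simp only [Finset.prod_const, Finset.card_univ, Fintype.card_fin]
        exact mul_le_mul_of_nonneg_right h4 (by positivity)
      rw [norm_mul, Real.norm_eq_abs, abs_of_nonneg (pow_nonneg (by linarith [ht.2]) _)]
      have h6 : (1 - t) ^ 3 ≤ 1 := pow_le_one₀ (by linarith [ht.2]) (by linarith [ht.1])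
      exact (mul_le_of_le_one_left (norm_nonneg _) h6).trans h5
    rw [sub_zero, abs_one, mul_one, Real.norm_eq_abs] at hI
    refine le_trans (mul_le_of_le_one_left (abs_nonneg _) ?_) hI
    simp [Nat.factorial]
    norm_num
  refine ⟨δ, hδ, 2 * M, by positivity, fun z hz => ?_⟩
  have ka := key z hz
  have kb := key (-z) (by rwa [norm_neg])
  -- Adding the expansions at `z` and `-z` cancels the terms of degree one and three.
  have hneg : ∀ k, iteratedFDeriv ℝ k g x (fun _ => -z) =
      (-1) ^ k * iteratedFDeriv ℝ k g x (fun _ => z) := by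
    intro k
    have := (iteratedFDeriv ℝ k g x).map_smul_univ (fun _ => (-1 : ℝ)) (fun _ => z)
    simpa using this
  have h20 : iteratedFDeriv ℝ 2 g x (fun _ => z) = fderiv ℝ (fderiv ℝ g) x z z := by
    rw [iteratedFDeriv_two_apply]
  simp only [hneg, norm_neg, ← sub_eq_add_neg] at kb
  simp only [Finset.sum_range_succ, Finset.sum_range_zero, h20, Nat.factorial] at ka kb
  norm_num at ka kb
  rw [abs_le] at ka kb ⊢
  constructor <;> linarith [ka.1, ka.2, kb.1, kb.2]

end Taylor

/-! ### Pointwise expansion of the density around `x`. -/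

section Expansion

variable {r : ℕ} {d : Fin r → ℕ} {f : Polysphere d → ℝ}

theorem radialExt_smul (f : Polysphere d → ℝ) (y : Polysphere d) {c : Fin r → ℝ}
    (hc : ∀ j, 0 < c j) : radialExt d f (fun j => c j • (y j : Ambient (d j))) = f y := by
  have hy : ∀ j, ‖(y j : Ambient (d j))‖ = 1 := fun j => norm_eq_of_mem_sphere _
  have h0 : ∀ j, c j • (y j : Ambient (d j)) ≠ 0 := fun j =>
    smul_ne_zero (hc j).ne' (norm_ne_zero_iff.1 (by rw [hy]; exact one_ne_zero))
  rw [radialExt, dif_pos h0]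
  congr 1
  funext j
  ext1
  simp [normalize, norm_smul, abs_of_pos (hc j), (hc j).ne', smul_smul]

theorem radialExt_toAmbient (f : Polysphere d → ℝ) (y : Polysphere d) :
    radialExt d f (toAmbient y) = f y := by
  rw [← radialExt_smul f y (c := fun _ => 1) fun _ => one_pos]
  simp only [one_smul]
  rfl

theorem RadialC4.continuous (hf : RadialC4 d f) : Continuous f := by
  have : f = radialExt d f ∘ toAmbient := funext fun y => (radialExt_toAmbient f y).symm
  rw [this, continuous_iff_continuousAt]
  intro y
  refine ContinuousAt.comp (hf y).continuousAt ?_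
  exact continuousAt_pi.2 fun j => (continuous_subtype_val.comp (continuous_apply j)).continuousAt

/-- The Hessian of the radial extension vanishes in the radial directions. -/
theorem RadialC4.hessian_radial (hf : RadialC4 d f) (x : Polysphere d) (j : Fin r) :
    fderiv ℝ (fderiv ℝ (radialExt d f)) (toAmbient x) (Pi.single j (x j : Ambient (d j)))
      (Pi.single j (x j : Ambient (d j))) = 0 := by
  obtain ⟨δ, hδ, C, hC, hT⟩ := exists_even_taylor_bound (hf x)
  set e : ∀ k, Ambient (d k) := Pi.single j (x j : Ambient (d j)) with he
  set B := fderiv ℝ (fderiv ℝ (radialExt d f)) (toAmbient x) with hB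
  have hne : ‖e‖ = 1 := by rw [he, Pi.norm_single, norm_eq_of_mem_sphere]
  -- The extension is constant along this segment, so the even Taylor bound reduces to `s² |B e e| ≤
  -- C s⁴`. Divide by `s²` and let `s → 0`.
  have hval : ∀ s : ℝ, |s| < 1 → radialExt d f (toAmbient x + s • e) = f x := by
    intro s hs
    rw [← radialExt_smul f x (c := Function.update (fun _ => (1 : ℝ)) j (1 + s))]
    · congr 1
      funext k
      by_cases h : k = j
      · subst h; simp [toAmbient, e, add_smul]
      · simp [toAmbient, e, h]
    · intro k
      by_cases h : k = j
      · subst h; simp; linarith [(abs_lt.1 hs).1]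
      · simp [h]
  have hbound : ∀ᶠ s : ℝ in nhdsWithin 0 (Set.Ioi 0), |B e e| ≤ C * s ^ 2 := by
    filter_upwards [Ioo_mem_nhdsGT (lt_min hδ one_pos)] with s hs
    have hs0 : 0 < s := hs.1
    have hs1 : |s| < 1 := by rw [abs_of_pos hs0]; exact hs.2.trans_le (min_le_right _ _)
    have hn : ‖s • e‖ = s := by rw [norm_smul, hne, mul_one, Real.norm_eq_abs, abs_of_pos hs0]
    have := hT (s • e) (by rw [hn]; exact hs.2.trans_le (min_le_left _ _))
    rw [sub_eq_add_neg (toAmbient x) (s • e), ← neg_smul, hval s hs1,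
      hval (-s) (by rwa [abs_neg]), radialExt_toAmbient, hn] at this
    simp only [map_smul, _root_.smul_apply, smul_eq_mul] at this
    rw [show f x + f x - 2 * f x - s * (s * B e e) = -(s ^ 2 * B e e) by ring, abs_neg, abs_mul,
      abs_of_pos (by positivity : 0 < s ^ 2)] at this
    have h2 : s ^ 2 * |B e e| ≤ s ^ 2 * (C * s ^ 2) := by linarith
    exact le_of_mul_le_mul_left h2 (by positivity)
  have hlim : Tendsto (fun s : ℝ => C * s ^ 2) (nhdsWithin 0 (Set.Ioi 0)) (nhds 0) := by
    have : Tendsto (fun s : ℝ => C * s ^ 2) (nhds 0) (nhds (C * 0 ^ 2)) :=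
      Continuous.tendsto (by fun_prop) 0
    simpa using this.mono_left nhdsWithin_le_nhds
  exact abs_nonpos_iff.1 (ge_of_tendsto hlim hbound)

/-- The deviation `∑ (1 - x_j'y_j)` of `y` from `x`. -/
noncomputable def gap (x y : Polysphere d) : ℝ :=
  ∑ j, (1 - inner ℝ (x j : Ambient (d j)) (y j))

theorem inner_le_one_sphere {n : ℕ} (x y : Sphere n) : inner ℝ (x : Ambient n) y ≤ 1 := by
  have := real_inner_le_norm (x : Ambient n) y
  rwa [norm_eq_of_mem_sphere, norm_eq_of_mem_sphere, one_mul] at this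

theorem gap_nonneg (x y : Polysphere d) : 0 ≤ gap x y :=
  Finset.sum_nonneg fun _ _ => sub_nonneg.2 (inner_le_one_sphere _ _)

theorem one_sub_inner_le_gap (x y : Polysphere d) (j : Fin r) :
    1 - inner ℝ (x j : Ambient (d j)) (y j) ≤ gap x y :=
  Finset.single_le_sum (f := fun j => 1 - inner ℝ (x j : Ambient (d j)) (y j))
    (fun _ _ => sub_nonneg.2 (inner_le_one_sphere _ _)) (Finset.mem_univ j)

theorem norm_tangent_le_one (x y : Polysphere d) : ‖tangent x y‖ ≤ 1 := by
  refine (pi_norm_le_iff_of_nonneg zero_le_one).2 fun j => ?_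
  have := norm_tangent_sq x y j
  nlinarith [norm_nonneg (tangent x y j), sq_nonneg (inner ℝ (x j : Ambient (d j)) (y j))]

/-- The ambient norm is the maximum over blocks, so it suffices that `1 - t² ≤ 2 (1 - t)` in each
block. -/
theorem norm_tangent_sq_le_gap (x y : Polysphere d) : ‖tangent x y‖ ^ 2 ≤ 2 * gap x y := by
  have h : ‖tangent x y‖ ≤ √(2 * gap x y) := by
    refine (pi_norm_le_iff_of_nonneg (Real.sqrt_nonneg _)).2 fun j => ?_
    refine Real.le_sqrt_of_sq_le ?_
    have h1 := norm_tangent_sq x y j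
    have h2 := one_sub_inner_le_gap x y j
    have h3 := inner_le_one_sphere (x j) (y j)
    nlinarith
  calc ‖tangent x y‖ ^ 2 ≤ √(2 * gap x y) ^ 2 := by gcongr
    _ = 2 * gap x y := Real.sq_sqrt (by linarith [gap_nonneg x y])

/-- Expansion of the average of `f` over a point and its reflection through `x`. -/
theorem RadialC4.exists_expansion (hf : RadialC4 d f) (x : Polysphere d)
    {V : ∀ j, Ambient (d j) ≃ₗᵢ[ℝ] Ambient (d j)} (hV : ∀ j, V j (x j) = x j)
    (hVn : ∀ j w, inner ℝ (x j : Ambient (d j)) w = 0 → V j w = -w) :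
    ∃ C, 0 ≤ C ∧ ∀ y, |f y + f (polyMap V y) - 2 * f x -
      fderiv ℝ (fderiv ℝ (radialExt d f)) (toAmbient x) (tangent x y) (tangent x y)|
        ≤ C * gap x y ^ 2 := by
  obtain ⟨δ, hδ, C, hC, hT⟩ := exists_even_taylor_bound (hf x)
  set B := fderiv ℝ (fderiv ℝ (radialExt d f)) (toAmbient x) with hB
  obtain ⟨F, hF⟩ := isCompact_univ.exists_bound_of_continuousOn hf.continuous.continuousOn
  have hF : ∀ y, |f y| ≤ F := fun y => hF y trivial
  have hF0 : 0 ≤ F := (abs_nonneg _).trans (hF x)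
  have hBb : ∀ u v, |B u v| ≤ ‖B‖ * ‖u‖ * ‖v‖ := fun u v => B.le_opNorm₂ u v
  -- Below `η`, the bound `1 / 2` keeps every `t_j ≥ 1 / 2`, and `δ² / 16` keeps `‖z‖² ≤ 4 ‖w‖² ≤ 8
  -- S` below `δ²`.
  set η := min (1 / 2) (δ ^ 2 / 16) with hη
  have hη0 : 0 < η := lt_min (by norm_num) (by positivity)
  -- The three terms come from the Taylor remainder at `z`, from replacing `z` by `w` in the
  -- Hessian, and from the crude bound where `S ≥ η`.
  refine ⟨64 * C + 12 * ‖B‖ + (4 * F + ‖B‖) / η ^ 2, by positivity, fun y => ?_⟩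
  set S := gap x y with hS
  have hS0 : 0 ≤ S := gap_nonneg x y
  set w := tangent x y with hw
  have hw2 : ‖w‖ ^ 2 ≤ 2 * S := norm_tangent_sq_le_gap x y
  by_cases hfar : η ≤ S
  · have h1 : |f y + f (polyMap V y) - 2 * f x - B w w| ≤ 4 * F + ‖B‖ := by
      have hw1 := norm_tangent_le_one x y
      have h2 : |B w w| ≤ ‖B‖ := by
        refine (hBb w w).trans ?_
        rw [mul_assoc]
        exact mul_le_of_le_one_right (by positivity) (mul_le_one₀ hw1 (norm_nonneg _) hw1)
      have a := abs_le.1 (hF y)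
      have b := abs_le.1 (hF (polyMap V y))
      have c := abs_le.1 (hF x)
      have e := abs_le.1 h2
      rw [abs_le]
      constructor <;> linarith [a.1, a.2, b.1, b.2, c.1, c.2, e.1, e.2]
    refine h1.trans ?_
    have h3 : 4 * F + ‖B‖ ≤ (4 * F + ‖B‖) / η ^ 2 * S ^ 2 := by
      rw [div_mul_eq_mul_div, le_div_iff₀ (by positivity)]
      gcongr
    have h4 : 0 ≤ (64 * C + 12 * ‖B‖) * S ^ 2 := by positivity
    linarith
  · push Not at hfar
    have hS1 : S ≤ 1 / 2 := hfar.le.trans (min_le_left _ _)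
    have hS2 : S < δ ^ 2 / 16 := hfar.trans_le (min_le_right _ _)
    set t : Fin r → ℝ := fun j => inner ℝ (x j : Ambient (d j)) (y j) with ht
    have htS : ∀ j, 1 - t j ≤ S := fun j => one_sub_inner_le_gap x y j
    have ht1 : ∀ j, t j ≤ 1 := fun j => inner_le_one_sphere _ _
    have ht2 : ∀ j, 1 / 2 ≤ t j := fun j => by linarith [htS j]
    have ht0 : ∀ j, 0 < t j := fun j => by linarith [ht2 j]
    have hti : ∀ j, (t j)⁻¹ ≤ 2 := fun j => by
      rw [inv_le_comm₀ (ht0 j) two_pos]; linarith [ht2 j]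
    -- Central projection onto the tangent space: `y_j / t_j = x_j + z_j`, while the reflected point
    -- gives `x_j - z_j`. The Taylor estimate thus applies to exactly opposite increments.
    let z : ∀ j, Ambient (d j) := fun j => (t j)⁻¹ • w j
    have hyw : ∀ j, (y j : Ambient (d j)) = t j • (x j : Ambient (d j)) + w j := fun j => by
      simp [hw, tangent, ht]
    have hfy : radialExt d f (toAmbient x + z) = f y := by
      rw [← radialExt_smul f y (c := fun j => (t j)⁻¹) fun j => inv_pos.2 (ht0 j)]
      congr 1
      funext j
      rw [hyw, smul_add, smul_smul, inv_mul_cancel₀ (ht0 j).ne', one_smul]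
      rfl
    have hfy' : radialExt d f (toAmbient x - z) = f (polyMap V y) := by
      rw [← radialExt_smul f (polyMap V y) (c := fun j => (t j)⁻¹) fun j => inv_pos.2 (ht0 j)]
      congr 1
      funext j
      simp only [polyMap, coe_sphereMap]
      rw [hyw, map_add, map_smul, hV, hVn j (w j) (inner_tangent x y j), smul_add, smul_smul,
        inv_mul_cancel₀ (ht0 j).ne', one_smul, smul_neg, ← sub_eq_add_neg]
      rfl
    have hz : ‖z‖ ≤ 2 * ‖w‖ := by
      refine (pi_norm_le_iff_of_nonneg (by positivity)).2 fun j => ?_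
      simp only [z]
      rw [norm_smul, Real.norm_eq_abs, abs_of_pos (inv_pos.2 (ht0 j))]
      exact mul_le_mul (hti j) (norm_le_pi_norm w j) (norm_nonneg _) zero_le_two
    -- Since `1 / t - 1 = (1 - t) / t`, the increments differ by an extra factor of order `S`.
    have hzw : ‖z - w‖ ≤ 2 * S * ‖w‖ := by
      refine (pi_norm_le_iff_of_nonneg (by positivity)).2 fun j => ?_
      have : (z - w) j = ((t j)⁻¹ * (1 - t j)) • w j := by
        simp only [z, Pi.sub_apply]
        rw [mul_sub, mul_one, inv_mul_cancel₀ (ht0 j).ne', sub_smul, one_smul]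
      rw [this, norm_smul, Real.norm_eq_abs,
        abs_of_nonneg (mul_nonneg (inv_pos.2 (ht0 j)).le (by linarith [ht1 j]))]
      exact mul_le_mul (mul_le_mul (hti j) (htS j) (by linarith [ht1 j]) zero_le_two)
        (norm_le_pi_norm w j) (norm_nonneg _) (by positivity)
    have hzδ : ‖z‖ < δ := by
      refine lt_of_pow_lt_pow_left₀ 2 hδ.le ?_
      calc ‖z‖ ^ 2 ≤ (2 * ‖w‖) ^ 2 := by gcongr
        _ = 4 * ‖w‖ ^ 2 := by ring
        _ < δ ^ 2 := by linarith
    have hTz := hT z hzδ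
    rw [hfy, hfy', radialExt_toAmbient] at hTz
    have hz4 : ‖z‖ ^ 4 ≤ 64 * S ^ 2 := by
      calc ‖z‖ ^ 4 ≤ (2 * ‖w‖) ^ 4 := by gcongr
        _ = 16 * (‖w‖ ^ 2) ^ 2 := by ring
        _ ≤ 16 * (2 * S) ^ 2 := by gcongr
        _ = 64 * S ^ 2 := by ring
    have hBd : |B z z - B w w| ≤ 12 * ‖B‖ * S ^ 2 := by
      have e : B z z - B w w = B (z - w) z + B w (z - w) := by
        simp only [map_sub, _root_.sub_apply]; ring
      rw [e]
      calc |B (z - w) z + B w (z - w)| ≤ ‖B‖ * ‖z - w‖ * ‖z‖ + ‖B‖ * ‖w‖ * ‖z - w‖ :=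
            (abs_add_le _ _).trans (add_le_add (hBb _ _) (hBb _ _))
        _ ≤ ‖B‖ * (2 * S * ‖w‖) * (2 * ‖w‖) + ‖B‖ * ‖w‖ * (2 * S * ‖w‖) := by gcongr
        _ = 6 * ‖B‖ * S * ‖w‖ ^ 2 := by ring
        _ ≤ 6 * ‖B‖ * S * (2 * S) := by gcongr
        _ = 12 * ‖B‖ * S ^ 2 := by ring
    have hfin : |f y + f (polyMap V y) - 2 * f x - B w w| ≤ C * ‖z‖ ^ 4 + 12 * ‖B‖ * S ^ 2 := by
      have e : f y + f (polyMap V y) - 2 * f x - B w w =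
        (f y + f (polyMap V y) - 2 * f x - B z z) + (B z z - B w w) := by ring
      rw [e]
      exact (abs_add_le _ _).trans (add_le_add hTz hBd)
    have h5 : C * ‖z‖ ^ 4 ≤ C * (64 * S ^ 2) := by gcongr
    have h6 : 0 ≤ (4 * F + ‖B‖) / η ^ 2 * S ^ 2 := by positivity
    linarith

end Expansion

/-! ### Convergence of the band weights to their limit. -/

section Weights

open Set Real

/-- A majorant for the distortion of the band weight, singular at `u = 1`. -/
noncomputable def distortion (u : ℝ) : ℝ := 1 + |1 - u| ^ (-(1 / 4) : ℝ)

theorem one_le_distortion (u : ℝ) : 1 ≤ distortion u :=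
  le_add_of_nonneg_right (rpow_nonneg (abs_nonneg _) _)

/-- The ratio of the band weight to its limit. -/
noncomputable def bandRatio (d : ℕ) (u : ℝ) : ℝ :=
  if u < 1 then (1 - u) ^ ((d : ℝ) / 2 - 1) else 0

theorem bandRatio_nonneg (d : ℕ) (u : ℝ) : 0 ≤ bandRatio d u := by
  unfold bandRatio
  split_ifs with h
  · exact rpow_nonneg (by linarith) _
  · exact le_rfl

theorem bandWeight_eq (d : ℕ) (h s : ℝ) :
    bandWeight d h s = s ^ ((d : ℝ) / 2 - 1) * 2 ^ ((d : ℝ) / 2 - 1) *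
      bandRatio d (h ^ 2 / 2 * s) := by
  unfold bandWeight bandRatio
  have : h ^ 2 * s < 2 ↔ h ^ 2 / 2 * s < 1 := by constructor <;> intro h <;> linarith
  by_cases h1 : h ^ 2 * s < 2
  · rw [if_pos h1, if_pos (this.1 h1), mul_assoc, ← mul_rpow zero_le_two (by linarith)]
    congr 2
    ring
  · rw [if_neg h1, if_neg (fun h2 => h1 (this.2 h2)), mul_zero]

/-- The exponent `d / 2 - 1` is at least `-1 / 2`, so the worst singularity is `(1 - u) ^ (-1 / 2)`,
covered by the squared distortion. Beyond `u = 1` the ratio is `0`, and its distance `1` from the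
limit is at most `(d + 1) * u`. -/
theorem bandRatio_le {d : ℕ} (hd : 1 ≤ d) {u : ℝ} (hu : 0 ≤ u) :
    bandRatio d u ≤ distortion u ^ 2 ∧
      |bandRatio d u - 1| ≤ ((d : ℝ) + 1) * u * distortion u ^ 2 := by
  have hd' : (1 : ℝ) ≤ d := by exact_mod_cast hd
  have hZ := one_le_distortion u
  have hZ2 : 1 ≤ distortion u ^ 2 := one_le_pow₀ hZ
  by_cases h1 : u < 1
  · have hq : 0 < 1 - u := by linarith
    have hq1 : 1 - u ≤ 1 := by linarith
    have e1 : (1 - u) ^ (-(1 / 2) : ℝ) ≤ distortion u ^ 2 := by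
      have : (1 - u) ^ (-(1 / 2) : ℝ) = ((1 - u) ^ (-(1 / 4) : ℝ)) ^ 2 := by
        rw [← rpow_mul_natCast hq.le]; norm_num
      rw [this, distortion, abs_of_pos hq]
      gcongr
      linarith
    have e2 : bandRatio d u ≤ (1 - u) ^ (-(1 / 2) : ℝ) := by
      rw [bandRatio, if_pos h1]
      exact rpow_le_rpow_of_exponent_ge hq hq1 (by linarith)
    have e3 : (1 - u) ^ (-(1 / 2) : ℝ) - 1 ≤ u * (1 - u) ^ (-(1 / 2) : ℝ) := by
      have : (1 - u) * (1 - u) ^ (-(1 / 2) : ℝ) ≤ 1 := by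
        conv_lhs => rw [← rpow_one (1 - u), ← rpow_mul hq.le, ← rpow_add hq]
        exact rpow_le_one hq.le hq1 (by norm_num)
      linarith
    -- Raise the exponent from `d / 2 - 1` to `d`, then apply Bernoulli's inequality.
    have e4 : 1 - d * u ≤ bandRatio d u := by
      have h2 : (1 - u) ^ d ≤ bandRatio d u := by
        rw [bandRatio, if_pos h1, ← rpow_natCast]
        exact rpow_le_rpow_of_exponent_ge hq hq1 (by linarith)
      have h3 := one_add_mul_le_pow (a := -u) (by linarith) d
      rw [← sub_eq_add_neg] at h3
      linarith
    refine ⟨e2.trans e1, abs_le.2 ⟨?_, ?_⟩⟩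
    · have : (d : ℝ) * u ≤ (d + 1) * u * distortion u ^ 2 :=
        (mul_le_mul_of_nonneg_right (by linarith) hu).trans
          (le_mul_of_one_le_right (by positivity) hZ2)
      linarith
    · have : u * (1 - u) ^ (-(1 / 2) : ℝ) ≤ (d + 1) * u * distortion u ^ 2 :=
        mul_le_mul (by nlinarith) e1 (rpow_nonneg hq.le _) (by positivity)
      linarith
  · rw [bandRatio, if_neg h1]
    refine ⟨by positivity, ?_⟩
    rw [zero_sub, abs_neg, abs_one]
    have h1 : 1 ≤ u := not_lt.1 h1
    have : 1 ≤ ((d : ℝ) + 1) * u := by nlinarith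
    exact one_le_mul_of_one_le_of_one_le this hZ2

/-- Telescope the product one factor at a time. The bounds `Y i ≥ 1` allow the full product to be
used in every term. -/
theorem abs_prod_sub_one_le {ι : Type*} (t : Finset ι) {ω Y ε : ι → ℝ} (h0 : ∀ i, 0 ≤ ω i)
    (hY : ∀ i, ω i ≤ Y i) (h1 : ∀ i, 1 ≤ Y i) (hε : ∀ i, |ω i - 1| ≤ ε i * Y i) :
    |∏ i ∈ t, ω i - 1| ≤ (∑ i ∈ t, ε i) * ∏ i ∈ t, Y i := by
  classical
  induction t using Finset.induction_on with
  | empty => simp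
  | insert a t ha ih =>
    rw [Finset.prod_insert ha, Finset.prod_insert ha, Finset.sum_insert ha]
    have hP0 : 0 ≤ ∏ i ∈ t, ω i := Finset.prod_nonneg fun i _ => h0 i
    have hPY : ∏ i ∈ t, ω i ≤ ∏ i ∈ t, Y i := Finset.prod_le_prod (fun i _ => h0 i) fun i _ => hY i
    have e : ω a * ∏ i ∈ t, ω i - 1 = (ω a - 1) * ∏ i ∈ t, ω i + (∏ i ∈ t, ω i - 1) := by ring
    rw [e]
    have b1 : |(ω a - 1) * ∏ i ∈ t, ω i| ≤ ε a * Y a * ∏ i ∈ t, Y i := by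
      rw [abs_mul, abs_of_nonneg hP0]
      exact mul_le_mul (hε a) hPY hP0 ((abs_nonneg _).trans (hε a))
    have b2 : |∏ i ∈ t, ω i - 1| ≤ (∑ i ∈ t, ε i) * (∏ i ∈ t, Y i) * Y a :=
      ih.trans (le_mul_of_one_le_right ((abs_nonneg _).trans ih) (h1 a))
    calc |(ω a - 1) * ∏ i ∈ t, ω i + (∏ i ∈ t, ω i - 1)|
        ≤ ε a * Y a * ∏ i ∈ t, Y i + (∑ i ∈ t, ε i) * (∏ i ∈ t, Y i) * Y a :=
          (abs_add_le _ _).trans (add_le_add b1 b2)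
      _ = _ := by ring

theorem sum_le_prod_one_add {ι : Type*} (t : Finset ι) {s : ι → ℝ} (h : ∀ i, 0 ≤ s i) :
    ∑ i ∈ t, s i ≤ ∏ i ∈ t, (1 + s i) := by
  classical
  suffices 1 + ∑ i ∈ t, s i ≤ ∏ i ∈ t, (1 + s i) by linarith
  induction t using Finset.induction_on with
  | empty => simp
  | insert a t ha ih =>
    rw [Finset.prod_insert ha, Finset.sum_insert ha]
    have h1 : 0 ≤ ∑ i ∈ t, s i := Finset.sum_nonneg fun i _ => h i
    nlinarith [h a, mul_le_mul_of_nonneg_left ih (by linarith [h a] : 0 ≤ 1 + s a),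
      mul_nonneg (h a) h1]

/-- Here `Z` is the distortion and `P` a polynomial. Where `Z ≤ P`, moments of `L` suffice. Where `Z
> P`, only `L ≤ M` is used, and one more power of `Z` buys the decay `1 / P`. The exponent `1 / 4`
in the distortion leaves room for this: the cube has a singularity of order `-3 / 4`, still
integrable. -/
theorem mul_sq_le_split {L M Z P : ℝ} (hL : 0 ≤ L) (hLM : L ≤ M) (hZ : 0 ≤ Z) (hP : 0 < P) :
    L * Z ^ 2 ≤ L * P ^ 2 + M * (Z ^ 3 / P) := by
  have hM : 0 ≤ M := hL.trans hLM
  rcases le_total Z P with h | h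
  · have : L * Z ^ 2 ≤ L * P ^ 2 := by gcongr
    have : 0 ≤ M * (Z ^ 3 / P) := by positivity
    linarith
  · have h1 : Z ^ 2 ≤ Z ^ 3 / P := by
      rw [le_div_iff₀ hP, pow_succ Z 2]; gcongr
    have h2 : L * Z ^ 2 ≤ M * (Z ^ 3 / P) := mul_le_mul hLM h1 (by positivity) hM
    have : 0 ≤ L * P ^ 2 := by positivity
    linarith

/-- A decaying weight with an integrable singularity at the origin. -/
noncomputable def decay (d : ℕ) (s : ℝ) : ℝ := s ^ ((d : ℝ) / 2 - 1) / (1 + s) ^ (d + 2)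

theorem decay_nonneg (d : ℕ) {s : ℝ} (hs : 0 ≤ s) : 0 ≤ decay d s :=
  div_nonneg (rpow_nonneg hs _) (by positivity)

/-- Near the singularity `s` is of order `1 / h²`, so this supplies a factor `h²`. -/
theorem decay_le_inv (d : ℕ) {s : ℝ} (hs : 0 < s) : decay d s ≤ s⁻¹ := by
  rw [decay, div_le_iff₀ (by positivity), rpow_sub_one hs.ne', div_eq_inv_mul]
  gcongr
  calc s ^ ((d : ℝ) / 2) ≤ (1 + s) ^ ((d : ℝ) / 2) := by gcongr; linarith
    _ ≤ (1 + s) ^ ((d + 2 : ℕ) : ℝ) := by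
        refine rpow_le_rpow_of_exponent_le (by linarith) ?_
        push_cast
        linarith [(Nat.cast_nonneg d : (0 : ℝ) ≤ d)]
    _ = (1 + s) ^ (d + 2) := rpow_natCast _ _

theorem integrableOn_decay {d : ℕ} (hd : 1 ≤ d) : IntegrableOn (decay d) (Ioi 0) := by
  have hd' : (1 : ℝ) ≤ d := by exact_mod_cast hd
  have hm : Measurable (decay d) := by unfold decay; fun_prop
  rw [← Ioc_union_Ioi_eq_Ioi zero_le_one]
  refine IntegrableOn.union ?_ ?_
  · have h : IntegrableOn (fun s : ℝ => s ^ ((d : ℝ) / 2 - 1)) (Ioc 0 1) :=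
      (intervalIntegral.intervalIntegrable_rpow' (by linarith)).1
    refine Integrable.mono' h hm.aestronglyMeasurable ?_
    filter_upwards [ae_restrict_mem measurableSet_Ioc] with s hs
    rw [norm_of_nonneg (decay_nonneg d hs.1.le)]
    exact div_le_self (rpow_nonneg hs.1.le _) (one_le_pow₀ (by linarith [hs.1]))
  · have h : IntegrableOn (fun s : ℝ => s ^ (-2 : ℝ)) (Ioi 1) :=
      integrableOn_Ioi_rpow_of_lt (by norm_num) one_pos
    refine Integrable.mono' h hm.aestronglyMeasurable ?_
    filter_upwards [ae_restrict_mem measurableSet_Ioi] with s hs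
    have hs1 : 1 < s := hs
    have hs0 : 0 < s := by linarith
    rw [norm_of_nonneg (decay_nonneg d hs0.le), decay, div_le_iff₀ (by positivity)]
    calc s ^ ((d : ℝ) / 2 - 1) ≤ s ^ ((-2 : ℝ) + (d + 2 : ℕ)) := by
          refine rpow_le_rpow_of_exponent_le hs1.le ?_
          push_cast; linarith
      _ = s ^ (-2 : ℝ) * s ^ (d + 2) := by rw [rpow_add hs0, rpow_natCast]
      _ ≤ s ^ (-2 : ℝ) * (1 + s) ^ (d + 2) := by gcongr; linarith

/-- The truncated singularity of the cube of the distortion. -/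
noncomputable def singularity : ℝ → ℝ :=
  (Icc (-(1 / 2)) (1 / 2)).indicator fun v => |v| ^ (-(3 / 4) : ℝ)

theorem singularity_nonneg (v : ℝ) : 0 ≤ singularity v :=
  indicator_nonneg (fun _ _ => rpow_nonneg (abs_nonneg _) _) _

theorem integrable_singularity : Integrable singularity := by
  have h1 : IntegrableOn (fun v : ℝ => |v| ^ (-(3 / 4) : ℝ)) (Ioc 0 (1 / 2)) := by
    have h : IntegrableOn (fun s : ℝ => s ^ (-(3 / 4) : ℝ)) (Ioc 0 (1 / 2)) :=
      (intervalIntegral.intervalIntegrable_rpow' (by norm_num)).1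
    refine h.congr_fun (fun v hv => ?_) measurableSet_Ioc
    simp only
    rw [abs_of_pos hv.1]
  have h2 : IntervalIntegrable (fun v : ℝ => |v| ^ (-(3 / 4) : ℝ)) volume 0 (1 / 2) := by
    rwa [intervalIntegrable_iff_integrableOn_Ioc_of_le (by norm_num)]
  have h3 : IntervalIntegrable (fun v : ℝ => |v| ^ (-(3 / 4) : ℝ)) volume (-(1 / 2)) 0 := by
    have := (h2.comp_mul_left (c := -1)).symm
    simpa [div_neg] using this
  have h4 := h3.trans h2
  rw [intervalIntegrable_iff_integrableOn_Icc_of_le (by norm_num)] at h4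
  exact (integrable_indicator_iff measurableSet_Icc).2 h4

/-- An integrable majorant for the weight times the cube of the distortion. -/
noncomputable def majorant (d : ℕ) (h s : ℝ) : ℝ :=
  12 * decay d s + 4 * (h ^ 2 * singularity (1 - h ^ 2 / 2 * s))

theorem majorant_nonneg (d : ℕ) (h : ℝ) {s : ℝ} (hs : 0 ≤ s) : 0 ≤ majorant d h s := by
  have := decay_nonneg d hs
  have := singularity_nonneg (1 - h ^ 2 / 2 * s)
  unfold majorant
  positivity

/-- If `|v| ≤ 1 / 2` then `s ≥ 1 / h²`, so the decay is at most `h²`. Otherwise `|v| ^ (-3 / 4) ≤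
2`. The factor `4` comes from `(1 + q)³ ≤ 4 (1 + q³)`. -/
theorem decay_mul_distortion_le (d : ℕ) (h : ℝ) {s : ℝ} (hs : 0 < s) :
    decay d s * distortion (h ^ 2 / 2 * s) ^ 3 ≤ majorant d h s := by
  set v := 1 - h ^ 2 / 2 * s with hv
  have h0 := decay_nonneg d hs.le
  have hq : 0 ≤ |v| ^ (-(1 / 4) : ℝ) := rpow_nonneg (abs_nonneg _) _
  have hcube : (|v| ^ (-(1 / 4) : ℝ)) ^ 3 = |v| ^ (-(3 / 4) : ℝ) := by
    rw [← rpow_mul_natCast (abs_nonneg _)]; norm_num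
  have e1 : distortion (h ^ 2 / 2 * s) ^ 3 ≤ 4 * (1 + |v| ^ (-(3 / 4) : ℝ)) := by
    rw [distortion, ← hv, ← hcube]
    set q := |v| ^ (-(1 / 4) : ℝ)
    nlinarith [mul_nonneg (by linarith : 0 ≤ q + 1) (sq_nonneg (q - 1))]
  have e2 : decay d s * |v| ^ (-(3 / 4) : ℝ) ≤ 2 * decay d s + h ^ 2 * singularity v := by
    by_cases hm : v ∈ Icc (-(1 / 2) : ℝ) (1 / 2)
    · rw [singularity, indicator_of_mem hm]
      have h1 : decay d s ≤ h ^ 2 := by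
        refine (decay_le_inv d hs).trans ?_
        rw [inv_le_iff_one_le_mul₀ hs]
        linarith [hm.2]
      have := mul_le_mul_of_nonneg_right h1 (rpow_nonneg (abs_nonneg v) (-(3 / 4) : ℝ))
      linarith
    · have h1 : 1 / 2 ≤ |v| := by
        by_contra hc
        exact hm (abs_le.1 (not_le.1 hc).le)
      have h2 : |v| ^ (-(3 / 4) : ℝ) ≤ 2 := by
        calc |v| ^ (-(3 / 4) : ℝ) ≤ (1 / 2 : ℝ) ^ (-(3 / 4) : ℝ) :=
              rpow_le_rpow_of_nonpos (by norm_num) h1 (by norm_num)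
          _ ≤ (1 / 2 : ℝ) ^ (-1 : ℝ) :=
              rpow_le_rpow_of_exponent_ge (by norm_num) (by norm_num) (by norm_num)
          _ = 2 := by rw [rpow_neg_one]; norm_num
      have h3 := mul_le_mul_of_nonneg_left h2 h0
      have h4 := mul_nonneg (sq_nonneg h) (singularity_nonneg v)
      linarith
  calc decay d s * distortion (h ^ 2 / 2 * s) ^ 3
      ≤ decay d s * (4 * (1 + |v| ^ (-(3 / 4) : ℝ))) := by gcongr
    _ = 4 * decay d s + 4 * (decay d s * |v| ^ (-(3 / 4) : ℝ)) := by ring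
    _ ≤ 4 * decay d s + 4 * (2 * decay d s + h ^ 2 * singularity v) := by gcongr
    _ = majorant d h s := by rw [majorant]; ring

/-- The bound is uniform in `h`: the factor `2 / h²` from the substitution `v = 1 - h² s / 2`
cancels the `h²` in the majorant. -/
theorem integral_majorant_le {d : ℕ} (hd : 1 ≤ d) {h : ℝ} (hh : 0 < h) :
    IntegrableOn (majorant d h) (Ioi 0) ∧
      ∫ s in Ioi 0, majorant d h s ≤ 12 * (∫ s in Ioi 0, decay d s) + 8 * ∫ v, singularity v := by
  have hc : h ^ 2 / 2 ≠ 0 := by positivity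
  have hi0 : Integrable fun v : ℝ => singularity (1 - v) := integrable_singularity.comp_sub_left 1
  have hi : Integrable fun s : ℝ => singularity (1 - h ^ 2 / 2 * s) := hi0.comp_mul_left' hc
  have hval : ∫ s, singularity (1 - h ^ 2 / 2 * s) = 2 / h ^ 2 * ∫ v, singularity v := by
    rw [Measure.integral_comp_mul_left (fun v => singularity (1 - v)), integral_sub_left_eq_self,
      abs_of_pos (by positivity), inv_div, smul_eq_mul]
  have hle : ∫ s in Ioi 0, singularity (1 - h ^ 2 / 2 * s) ≤ 2 / h ^ 2 * ∫ v, singularity v := by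
    rw [← hval]
    exact setIntegral_le_integral hi (Eventually.of_forall fun _ => singularity_nonneg _)
  have ia := (integrableOn_decay hd).const_mul 12
  have ib : IntegrableOn (fun s => 4 * (h ^ 2 * singularity (1 - h ^ 2 / 2 * s))) (Ioi 0) :=
    ((hi.const_mul _).const_mul _).integrableOn
  refine ⟨ia.add ib, ?_⟩
  unfold majorant
  rw [integral_add ia ib, integral_const_mul, integral_const_mul, integral_const_mul]
  have : h ^ 2 * ∫ s in Ioi 0, singularity (1 - h ^ 2 / 2 * s) ≤ 2 * ∫ v, singularity v := by
    calc _ ≤ h ^ 2 * (2 / h ^ 2 * ∫ v, singularity v) := by gcongr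
      _ = 2 * ∫ v, singularity v := by field_simp
  linarith

variable {r : ℕ} {d : Fin r → ℕ} {L : (Fin r → ℝ) → ℝ}

/-- Expand by the binomial theorem. A factor `s_j ^ k` shifts `e_j = d_j` to `d_j + 2k`, so the
integrability assumption for all integer exponents gives every polynomial moment. -/
theorem IsKernel.integrableOn_moments (hL : IsKernel L) (hd : ∀ j, 1 ≤ d j) (N : Fin r → ℕ) :
    IntegrableOn (fun s => L s * ∏ j, ((1 + s j) ^ N j * s j ^ ((d j : ℝ) / 2 - 1)))
      (posOrthant r) := by
  have hexp : ∀ s ∈ posOrthant r, (∑ k ∈ Fintype.piFinset fun j => Finset.range (N j + 1),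
      (∏ j, ((N j).choose (k j) : ℝ)) *
        (L s ^ 1 * ∏ j, s j ^ (((d j + 2 * k j : ℕ) : ℝ) / 2 - 1))) =
      L s * ∏ j, ((1 + s j) ^ N j * s j ^ ((d j : ℝ) / 2 - 1)) := by
    intro s hs
    have h1 : ∀ j, (1 + s j) ^ N j * s j ^ ((d j : ℝ) / 2 - 1) =
        ∑ k ∈ Finset.range (N j + 1),
          ((N j).choose k : ℝ) * s j ^ (((d j + 2 * k : ℕ) : ℝ) / 2 - 1) := by
      intro j
      rw [add_comm, add_pow, Finset.sum_mul]
      refine Finset.sum_congr rfl fun k _ => ?_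
      have : (((d j + 2 * k : ℕ) : ℝ) / 2 - 1) = ((d j : ℝ) / 2 - 1) + (k : ℕ) := by
        push_cast; ring
      rw [this, rpow_add (hs j), rpow_natCast]
      ring
    simp_rw [h1]
    rw [Finset.prod_univ_sum, Finset.mul_sum]
    refine Finset.sum_congr rfl fun k _ => ?_
    rw [Finset.prod_mul_distrib]
    ring
  refine IntegrableOn.congr_fun ?_ hexp (measurableSet_posOrthant r)
  refine integrable_finsetSum _ fun k _ => Integrable.const_mul ?_ _
  exact hL.integrable 1 (Or.inl rfl) (fun j => d j + 2 * k j) fun j => by have := hd j; omega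

/-- The integral of a kernel of moderate growth against the band weights converges to its limit at
the rate of the squared bandwidths. -/
theorem IsKernel.exists_bandWeight_bound (hL : IsKernel L) (hd : ∀ j, 1 ≤ d j) (N : ℕ) :
    ∃ C, 0 ≤ C ∧ ∀ p : (Fin r → ℝ) → ℝ, Measurable p →
      (∀ s ∈ posOrthant r, |p s| ≤ ∏ j, (1 + s j) ^ N) →
      IntegrableOn (fun s => L s * p s *
        ∏ j, (s j ^ ((d j : ℝ) / 2 - 1) * (2 : ℝ) ^ ((d j : ℝ) / 2 - 1))) (posOrthant r) ∧
      ∀ h : Fin r → ℝ, (∀ j, 0 < h j) →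
        IntegrableOn (fun s => L s * p s * ∏ j, bandWeight (d j) (h j) (s j)) (posOrthant r) ∧
        |(∫ s in posOrthant r, L s * p s * ∏ j, bandWeight (d j) (h j) (s j)) -
          ∫ s in posOrthant r, L s * p s *
            ∏ j, (s j ^ ((d j : ℝ) / 2 - 1) * (2 : ℝ) ^ ((d j : ℝ) / 2 - 1))|
          ≤ C * ∑ j, h j ^ 2 := by
  obtain ⟨M, hM⟩ := hL.bounded
  have hM0 : 0 ≤ M := (hL.nonneg 0 fun _ => le_rfl).trans (hM 0 fun _ => le_rfl)
  set c₀ : ℝ := ∏ j, (2 : ℝ) ^ ((d j : ℝ) / 2 - 1) with hc₀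
  have hc₀0 : 0 ≤ c₀ := Finset.prod_nonneg fun j _ => rpow_nonneg zero_le_two _
  set D : ℝ := ∑ j, ((d j : ℝ) + 1) with hD
  have hD0 : 0 ≤ D := Finset.sum_nonneg fun j _ => by positivity
  -- Dividing by `(1 + s j) ^ K j` absorbs the growth `N` of `p` and one factor `1 + s j` from the
  -- ratio bound, and leaves the denominator `(1 + s j) ^ (d j + 2)` of `decay`.
  set K : Fin r → ℕ := fun j => N + 1 + (d j + 2) with hK
  -- `G` dominates the part controlled by moments of `L`; the product `H` of majorants below
  -- dominates the part where only `L ≤ M` is used.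
  set G : (Fin r → ℝ) → ℝ := fun s => L s *
    ∏ j, ((1 + s j) ^ (N + 1 + 2 * K j) * s j ^ ((d j : ℝ) / 2 - 1)) with hG
  have hGi : IntegrableOn G (posOrthant r) := hL.integrableOn_moments hd _
  set I : ℝ := ∏ j, (12 * (∫ s in Ioi 0, decay (d j) s) + 8 * ∫ v, singularity v) with hI
  have hGint0 : 0 ≤ ∫ s in posOrthant r, G s := by
    refine setIntegral_nonneg (measurableSet_posOrthant r) fun s hs => ?_
    exact mul_nonneg (hL.nonneg s fun j => (hs j).le) (Finset.prod_nonneg fun j _ =>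
      mul_nonneg (pow_nonneg (by linarith [hs j]) _) (rpow_nonneg (hs j).le _))
  have hI0 : 0 ≤ I := Finset.prod_nonneg fun j _ => by
    have h1 : 0 ≤ ∫ s in Ioi 0, decay (d j) s :=
      setIntegral_nonneg measurableSet_Ioi fun s hs => decay_nonneg _ (le_of_lt hs)
    have h2 : 0 ≤ ∫ v, singularity v := integral_nonneg singularity_nonneg
    positivity
  refine ⟨c₀ * D * ((∫ s in posOrthant r, G s) + M * I), by positivity, fun p hp hpb => ?_⟩
  have hW : ∀ s : Fin r → ℝ, ∏ j, (s j ^ ((d j : ℝ) / 2 - 1) * (2 : ℝ) ^ ((d j : ℝ) / 2 - 1)) =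
      c₀ * ∏ j, s j ^ ((d j : ℝ) / 2 - 1) := fun s => by
    rw [Finset.prod_mul_distrib, mul_comm]
  have hmeasL := hL.measurable
  have hi0 : IntegrableOn (fun s => L s * p s *
        ∏ j, (s j ^ ((d j : ℝ) / 2 - 1) * (2 : ℝ) ^ ((d j : ℝ) / 2 - 1))) (posOrthant r) := by
    refine Integrable.mono' ((hL.integrableOn_moments hd fun _ => N).const_mul c₀)
      (by fun_prop) ?_
    filter_upwards [ae_restrict_mem (measurableSet_posOrthant r)] with s hs
    have hL0 := hL.nonneg s fun j => (hs j).le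
    have hS0 : 0 ≤ ∏ j, s j ^ ((d j : ℝ) / 2 - 1) :=
      Finset.prod_nonneg fun j _ => rpow_nonneg (hs j).le _
    rw [hW, norm_eq_abs, abs_mul, abs_mul, abs_of_nonneg hL0, abs_of_nonneg (mul_nonneg hc₀0 hS0),
      Finset.prod_mul_distrib]
    calc L s * |p s| * (c₀ * ∏ j, s j ^ ((d j : ℝ) / 2 - 1))
        ≤ L s * (∏ j, (1 + s j) ^ N) * (c₀ * ∏ j, s j ^ ((d j : ℝ) / 2 - 1)) := by
          gcongr; exact hpb s hs
      _ = c₀ * (L s * ((∏ j, (1 + s j) ^ N) * ∏ j, s j ^ ((d j : ℝ) / 2 - 1))) := by ring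
  refine ⟨hi0, fun h hh => ?_⟩
  set η : ℝ := ∑ j, h j ^ 2 with hη
  have hη0 : 0 ≤ η := Finset.sum_nonneg fun j _ => sq_nonneg _
  set H : (Fin r → ℝ) → ℝ := fun s => ∏ j, majorant (d j) (h j) (s j) with hH
  have hHi : IntegrableOn H (posOrthant r) := by
    rw [IntegrableOn, volume_restrict_posOrthant]
    exact Integrable.fintype_prod fun j => (integral_majorant_le (hd j) (hh j)).1
  have hHI : ∫ s in posOrthant r, H s ≤ I := by
    rw [volume_restrict_posOrthant, hH, integral_fintype_prod_eq_prod
      (f := fun j s => majorant (d j) (h j) s)]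
    exact Finset.prod_le_prod (fun j _ => setIntegral_nonneg measurableSet_Ioi
      fun s hs => majorant_nonneg _ _ (le_of_lt hs)) fun j _ => (integral_majorant_le (hd j) (hh j)).2
  have hpt : ∀ s ∈ posOrthant r, ‖L s * p s * ∏ j, bandWeight (d j) (h j) (s j) -
      L s * p s * ∏ j, (s j ^ ((d j : ℝ) / 2 - 1) * (2 : ℝ) ^ ((d j : ℝ) / 2 - 1))‖ ≤
      c₀ * D * η * (G s + M * H s) := by
    intro s hs
    have hs0 : ∀ j, 0 ≤ s j := fun j => (hs j).le
    have hL0 := hL.nonneg s hs0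
    have hLM := hM s hs0
    set S := ∏ j, s j ^ ((d j : ℝ) / 2 - 1) with hS
    have hS0 : 0 ≤ S := Finset.prod_nonneg fun j _ => rpow_nonneg (hs0 j) _
    set Q := ∏ j, (1 + s j) with hQ
    have hQ0 : 0 ≤ Q := Finset.prod_nonneg fun j _ => by linarith [hs0 j]
    set Z := ∏ j, distortion (h j ^ 2 / 2 * s j) with hZ
    have hZ0 : 0 ≤ Z := Finset.prod_nonneg fun j _ => zero_le_one.trans (one_le_distortion _)
    set P := ∏ j, (1 + s j) ^ K j with hP
    have hP0 : 0 < P := Finset.prod_pos fun j _ => pow_pos (by linarith [hs0 j]) _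
    have hband : ∏ j, bandWeight (d j) (h j) (s j) =
        c₀ * S * ∏ j, bandRatio (d j) (h j ^ 2 / 2 * s j) := by
      rw [← hW, ← Finset.prod_mul_distrib]
      exact Finset.prod_congr rfl fun j _ => bandWeight_eq _ _ _
    have hu : ∀ j, 0 ≤ h j ^ 2 / 2 * s j := fun j => mul_nonneg (by positivity) (hs0 j)
    have hratio : |∏ j, bandRatio (d j) (h j ^ 2 / 2 * s j) - 1| ≤ D * η * Q * Z ^ 2 := by
      have := abs_prod_sub_one_le (Finset.univ : Finset (Fin r))
        (ω := fun j => bandRatio (d j) (h j ^ 2 / 2 * s j))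
        (Y := fun j => distortion (h j ^ 2 / 2 * s j) ^ 2)
        (ε := fun j => ((d j : ℝ) + 1) * (h j ^ 2 / 2 * s j))
        (fun j => bandRatio_nonneg _ _) (fun j => (bandRatio_le (hd j) (hu j)).1)
        (fun j => one_le_pow₀ (one_le_distortion _)) (fun j => (bandRatio_le (hd j) (hu j)).2)
      refine this.trans ?_
      rw [Finset.prod_pow]
      refine mul_le_mul_of_nonneg_right ?_ (by positivity)
      calc ∑ j, ((d j : ℝ) + 1) * (h j ^ 2 / 2 * s j) ≤ ∑ j, D * η * s j := by
            refine Finset.sum_le_sum fun j _ => ?_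
            have h1 : (d j : ℝ) + 1 ≤ D := Finset.single_le_sum (f := fun j => (d j : ℝ) + 1)
              (fun j _ => by positivity) (Finset.mem_univ j)
            have h2 : h j ^ 2 ≤ η := Finset.single_le_sum (f := fun j => h j ^ 2)
              (fun j _ => sq_nonneg _) (Finset.mem_univ j)
            have h3 : h j ^ 2 / 2 ≤ η := by linarith [sq_nonneg (h j)]
            rw [← mul_assoc]
            exact mul_le_mul_of_nonneg_right (mul_le_mul h1 h3 (by positivity) hD0) (hs0 j)
        _ = D * η * ∑ j, s j := (Finset.mul_sum _ _ _).symm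
        _ ≤ D * η * Q := by gcongr; exact sum_le_prod_one_add _ hs0
    have hp1 : |p s| ≤ Q ^ N := (hpb s hs).trans_eq (Finset.prod_pow _ _ _)
    have hGs : G s = L s * (Q ^ (N + 1) * P ^ 2 * S) := by
      rw [hG, hQ, hP, hS, ← Finset.prod_pow, ← Finset.prod_pow, ← Finset.prod_mul_distrib,
        ← Finset.prod_mul_distrib]
      simp only
      congr 1
      refine Finset.prod_congr rfl fun j _ => ?_
      rw [pow_add, mul_comm 2 (K j), pow_mul]
    have hHs : Q ^ (N + 1) * S * (Z ^ 3 / P) ≤ H s := by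
      have : Q ^ (N + 1) * S * (Z ^ 3 / P) =
          ∏ j, decay (d j) (s j) * distortion (h j ^ 2 / 2 * s j) ^ 3 := by
        rw [hQ, hP, hS, hZ, ← Finset.prod_pow, ← Finset.prod_pow, ← Finset.prod_div_distrib,
          ← Finset.prod_mul_distrib, ← Finset.prod_mul_distrib]
        refine Finset.prod_congr rfl fun j _ => ?_
        have : (1 + s j) ≠ 0 := by linarith [hs0 j]
        rw [decay, hK]
        simp only
        rw [pow_add (1 + s j) (N + 1) (d j + 2)]
        field_simp
      rw [this]
      exact Finset.prod_le_prod (fun j _ => mul_nonneg (decay_nonneg _ (hs0 j))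
        (pow_nonneg (zero_le_one.trans (one_le_distortion _)) _))
        fun j _ => decay_mul_distortion_le _ _ (hs j)
    rw [hband, hW, ← mul_sub, ← mul_sub_one, norm_eq_abs, abs_mul, abs_mul, abs_mul,
      abs_of_nonneg hL0, abs_of_nonneg (mul_nonneg hc₀0 hS0)]
    calc L s * |p s| * (c₀ * S * |∏ j, bandRatio (d j) (h j ^ 2 / 2 * s j) - 1|)
        ≤ L s * Q ^ N * (c₀ * S * (D * η * Q * Z ^ 2)) := by gcongr
      _ = c₀ * D * η * (Q ^ (N + 1) * S * (L s * Z ^ 2)) := by ring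
      _ ≤ c₀ * D * η * (Q ^ (N + 1) * S * (L s * P ^ 2 + M * (Z ^ 3 / P))) := by
          gcongr; exact mul_sq_le_split hL0 hLM hZ0 hP0
      _ = c₀ * D * η * (G s + M * (Q ^ (N + 1) * S * (Z ^ 3 / P))) := by rw [hGs]; ring
      _ ≤ c₀ * D * η * (G s + M * H s) := by gcongr
  have hmw := fun j => measurable_bandWeight (d j) (h j)
  have hDi : IntegrableOn (fun s => c₀ * D * η * (G s + M * H s)) (posOrthant r) :=
    (hGi.add (hHi.const_mul M)).const_mul (c₀ * D * η)
  have hdi : IntegrableOn (fun s => L s * p s * ∏ j, bandWeight (d j) (h j) (s j) -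
      L s * p s * ∏ j, (s j ^ ((d j : ℝ) / 2 - 1) * (2 : ℝ) ^ ((d j : ℝ) / 2 - 1)))
      (posOrthant r) := by
    refine Integrable.mono' hDi (by fun_prop) ?_
    filter_upwards [ae_restrict_mem (measurableSet_posOrthant r)] with s hs using hpt s hs
  have hih : IntegrableOn (fun s => L s * p s * ∏ j, bandWeight (d j) (h j) (s j))
      (posOrthant r) := by
    refine (hdi.add hi0).congr (Eventually.of_forall fun s => ?_)
    simp
  refine ⟨hih, ?_⟩
  rw [← integral_sub hih hi0]
  calc |∫ s in posOrthant r, (L s * p s * ∏ j, bandWeight (d j) (h j) (s j) -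
      L s * p s * ∏ j, (s j ^ ((d j : ℝ) / 2 - 1) * (2 : ℝ) ^ ((d j : ℝ) / 2 - 1)))|
      ≤ ∫ s in posOrthant r, c₀ * D * η * (G s + M * H s) := by
        rw [← norm_eq_abs]
        refine norm_integral_le_of_norm_le hDi ?_
        filter_upwards [ae_restrict_mem (measurableSet_posOrthant r)] with s hs using hpt s hs
    _ = c₀ * D * η * ((∫ s in posOrthant r, G s) + M * ∫ s in posOrthant r, H s) := by
        rw [integral_const_mul, integral_add hGi (hHi.const_mul M), integral_const_mul M]
    _ ≤ c₀ * D * η * ((∫ s in posOrthant r, G s) + M * I) := by gcongr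
    _ = _ := by ring

end Weights

/-! ### Expansion of the smoothed density. -/

section Kernel

variable {r : ℕ} {d : Fin r → ℕ} {L : (Fin r → ℝ) → ℝ}

/-- The scaled deviations `(1 - x_j'y_j) / h_j²`. -/
noncomputable def scaledGap (h : Fin r → ℝ) (x y : Polysphere d) : Fin r → ℝ :=
  fun j => (1 - inner ℝ (x j : Ambient (d j)) (y j)) / h j ^ 2

theorem continuous_scaledGap (h : Fin r → ℝ) (x : Polysphere d) :
    Continuous (scaledGap h x) := by
  unfold scaledGap
  fun_prop

theorem scaledGap_nonneg (h : Fin r → ℝ) (x y : Polysphere d) (j : Fin r) :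
    0 ≤ scaledGap h x y j :=
  div_nonneg (sub_nonneg.2 (inner_le_one_sphere _ _)) (sq_nonneg _)

theorem scaledGap_comm (h : Fin r → ℝ) (x y : Polysphere d) :
    scaledGap h x y = scaledGap h y x := by
  funext j
  simp only [scaledGap]
  rw [real_inner_comm]

theorem rawKernel_eq (h : Fin r → ℝ) (x y : Polysphere d) :
    rawKernel L h x y = L (scaledGap h x y) := rfl

theorem IsKernel.rawKernel_nonneg (hL : IsKernel L) (h : Fin r → ℝ) (x y : Polysphere d) :
    0 ≤ rawKernel L h x y := hL.nonneg _ (scaledGap_nonneg h x y)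

theorem IsKernel.measurable_rawKernel (hL : IsKernel L) (h : Fin r → ℝ) (x : Polysphere d) :
    Measurable (rawKernel L h x) :=
  hL.measurable.comp (continuous_scaledGap h x).measurable

theorem IsKernel.exists_rawKernel_bound (hL : IsKernel L) (h : Fin r → ℝ) (x : Polysphere d) :
    ∃ M, ∀ y, ‖rawKernel L h x y‖ ≤ M := by
  obtain ⟨M, hM⟩ := hL.bounded
  refine ⟨M, fun y => ?_⟩
  rw [Real.norm_of_nonneg (hL.rawKernel_nonneg h x y)]
  exact hM _ (scaledGap_nonneg h x y)

theorem IsKernel.integrable_rawKernel (hL : IsKernel L) (h : Fin r → ℝ) (x : Polysphere d) :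
    Integrable (rawKernel L h x) (polyMeasure d) := by
  obtain ⟨M, hM⟩ := hL.exists_rawKernel_bound h x
  exact Integrable.of_bound (hL.measurable_rawKernel h x).aestronglyMeasurable M
    (Eventually.of_forall hM)

theorem isZonal_rawKernel (h : Fin r → ℝ) (x : Polysphere d) : IsZonal x (rawKernel L h x) := by
  intro U hU y
  rw [rawKernel_eq, rawKernel_eq]
  congr 1
  funext j
  simp only [scaledGap, polyMap, coe_sphereMap]
  conv_lhs => rw [← hU j]
  rw [(U j).inner_map_map]

theorem gap_le_scaledGap {h : Fin r → ℝ} (hh : ∀ j, 0 < h j) (x y : Polysphere d) :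
    gap x y ≤ (∑ j, h j ^ 2) * ∑ j, scaledGap h x y j := by
  rw [gap, Finset.mul_sum]
  refine Finset.sum_le_sum fun j _ => ?_
  have h1 : h j ^ 2 ≤ ∑ j, h j ^ 2 :=
    Finset.single_le_sum (f := fun j => h j ^ 2) (fun j _ => sq_nonneg _) (Finset.mem_univ j)
  have h2 : 1 - inner ℝ (x j : Ambient (d j)) (y j) = h j ^ 2 * scaledGap h x y j := by
    have := (hh j).ne'
    simp only [scaledGap]
    field_simp
  rw [h2]
  exact mul_le_mul_of_nonneg_right h1 (scaledGap_nonneg h x y j)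

/-- The limit weight `∏ s_j^{d_j/2-1} 2^{d_j/2-1}`. -/
noncomputable def limitWeight (d : Fin r → ℕ) (s : Fin r → ℝ) : ℝ :=
  ∏ j, (s j ^ ((d j : ℝ) / 2 - 1) * (2 : ℝ) ^ ((d j : ℝ) / 2 - 1))

/-- The kernel integral `∫ L p` against the band weights. -/
noncomputable def bandIntegral (d : Fin r → ℕ) (L : (Fin r → ℝ) → ℝ) (h : Fin r → ℝ)
    (p : (Fin r → ℝ) → ℝ) : ℝ :=
  ∫ s in posOrthant r, L s * p s * ∏ j, bandWeight (d j) (h j) (s j)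

/-- The kernel integral `∫ L p` against the limit weight. -/
noncomputable def limitIntegral (d : Fin r → ℕ) (L : (Fin r → ℝ) → ℝ) (p : (Fin r → ℝ) → ℝ) : ℝ :=
  ∫ s in posOrthant r, L s * p s * limitWeight d s

theorem IsKernel.limitIntegral_one_pos (hL : IsKernel L) (hd : ∀ j, 1 ≤ d j) :
    0 < limitIntegral d L fun _ => 1 := by
  have h := hL.integral_pos 1 (Or.inl rfl) d hd
  have hc : 0 < ∏ j, (2 : ℝ) ^ ((d j : ℝ) / 2 - 1) :=
    Finset.prod_pos fun j _ => Real.rpow_pos_of_pos two_pos _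
  have : limitIntegral d L (fun _ => 1) = (∫ s in posOrthant r,
      L s ^ 1 * ∏ j, s j ^ ((d j : ℝ) / 2 - 1)) * ∏ j, (2 : ℝ) ^ ((d j : ℝ) / 2 - 1) := by
    rw [limitIntegral, ← integral_mul_const]
    refine integral_congr_ae (Eventually.of_forall fun s => ?_)
    simp only [limitWeight, Finset.prod_mul_distrib]
    ring
  rw [this]
  exact mul_pos h hc

/-- The sphere areas are nonzero and cancel, so the constant in the law of the scaled deviations
need not be identified. -/
theorem kernelMoment_eq (d : Fin r → ℕ) (L : (Fin r → ℝ) → ℝ) (j : Fin r) :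
    kernelMoment d L j =
      limitIntegral d L (fun s => s j) / (d j * limitIntegral d L fun _ => 1) := by
  have hω : ∏ k, sphereArea (d k - 1) ≠ 0 := by
    refine Finset.prod_ne_zero_iff.2 fun k _ => ?_
    have : surfaceMeasure (d k - 1) Set.univ ≠ 0 := by
      rw [Ne, Measure.measure_univ_eq_zero]
      exact Measure.toSphere_ne_zero _
    rw [sphereArea, measureReal_def]
    exact (ENNReal.toReal_pos this (measure_ne_top _ _)).ne'
  unfold kernelMoment lam limitIntegral limitWeight
  simp only [mul_one]
  rw [mul_left_comm, mul_div_mul_left _ _ hω]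

/-- The main expansion of the unnormalized mean, with the remainder kept as an integral. -/
theorem RadialC4.exists_integral_expansion {f : Polysphere d → ℝ} (hf : RadialC4 d f)
    (hd : ∀ j, 1 ≤ d j) (hL : IsKernel L) (x : Polysphere d) :
    ∃ C, 0 ≤ C ∧ ∀ h : Fin r → ℝ,
      |(∫ y, rawKernel L h x y * f y ∂(polyMeasure d)) -
        (f x * ∫ y, rawKernel L h x y ∂(polyMeasure d)) -
        ∑ j, (hessianBlock d (radialExt d f) (toAmbient x) j).trace / d j *
          ∫ y, rawKernel L h x y * (1 - inner ℝ (x j : Ambient (d j)) (y j)) ∂(polyMeasure d)|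
      ≤ C * ∫ y, rawKernel L h x y * gap x y ^ 2 ∂(polyMeasure d) := by
  choose V hV hVn using fun j => exists_isometry_neg_orthogonal (x j : Ambient (d j))
  obtain ⟨C, hC, hexp⟩ := hf.exists_expansion x hV hVn
  set B := fderiv ℝ (fderiv ℝ (radialExt d f)) (toAmbient x) with hB
  set τ : Fin r → ℝ := fun j => (hessianBlock d (radialExt d f) (toAmbient x) j).trace / d j with hτ
  refine ⟨(C + ∑ j, |τ j|) / 2, by positivity, fun h => ?_⟩
  set K := rawKernel L h x with hK
  have hKi : Integrable K (polyMeasure d) := hL.integrable_rawKernel h x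
  have hK0 : ∀ y, 0 ≤ K y := hL.rawKernel_nonneg h x
  have hz : IsZonal x K := isZonal_rawKernel h x
  have hfc := hf.continuous
  have htc := continuous_tangent x
  have hvc : ∀ j, Continuous fun y : Polysphere d => 1 - inner ℝ (x j : Ambient (d j)) (y j) :=
    fun j => by fun_prop
  have hgc : Continuous (gap x) := by unfold gap; fun_prop
  set A := ∫ y, K y * gap x y ^ 2 ∂(polyMeasure d) with hA
  have hgi : Integrable (fun y => K y * gap x y ^ 2) (polyMeasure d) :=
    integrable_mul_continuous hKi (hgc.pow 2)
  have hpc : Continuous (polyMap V) := by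
    refine continuous_pi fun j => Continuous.subtype_mk ?_ _
    exact (V j).continuous.comp (continuous_subtype_val.comp (continuous_apply j))
  have i1 := integrable_mul_continuous hKi hfc
  have i2 : Integrable (fun y => K y * f (polyMap V y)) (polyMeasure d) :=
    integrable_mul_continuous hKi (hfc.comp hpc)
  have i3 : Integrable (fun y => K y * (2 * f x)) (polyMeasure d) := hKi.mul_const _
  have i4 : Integrable (fun y => K y * B (tangent x y) (tangent x y)) (polyMeasure d) :=
    integrable_mul_continuous hKi (by fun_prop)
  have hR : |∫ y, K y * (f y + f (polyMap V y) - 2 * f x - B (tangent x y) (tangent x y))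
      ∂(polyMeasure d)| ≤ C * A := by
    rw [hA, ← integral_const_mul, ← Real.norm_eq_abs]
    refine norm_integral_le_of_norm_le (hgi.const_mul C) (Eventually.of_forall fun y => ?_)
    rw [Real.norm_eq_abs, abs_mul, abs_of_nonneg (hK0 y)]
    calc _ ≤ K y * (C * gap x y ^ 2) := mul_le_mul_of_nonneg_left (hexp y) (hK0 y)
      _ = _ := by ring
  -- The reflection fixes `x`, so by zonality both values of `f` have the same integral against `K`.
  have hRe : ∫ y, K y * (f y + f (polyMap V y) - 2 * f x - B (tangent x y) (tangent x y))
      ∂(polyMeasure d) = 2 * (∫ y, K y * f y ∂(polyMeasure d)) -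
        2 * (f x * ∫ y, K y ∂(polyMeasure d)) -
        ∫ y, K y * B (tangent x y) (tangent x y) ∂(polyMeasure d) := by
    simp_rw [mul_sub, mul_add]
    have i12 : Integrable (fun y => K y * f y + K y * f (polyMap V y)) (polyMeasure d) := i1.add i2
    have i123 : Integrable (fun y => K y * f y + K y * f (polyMap V y) - K y * (2 * f x))
      (polyMeasure d) := i12.sub i3
    rw [integral_sub i123 i4, integral_sub i12 i3, integral_add i1 i2,
      hz.integral_mul_comp hKi hV hfc, integral_mul_const]
    ring
  set a : Fin r → ℝ := fun j =>
    ∫ y, K y * (1 - inner ℝ (x j : Ambient (d j)) (y j)) ∂(polyMeasure d) with ha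
  set q : Fin r → ℝ := fun j =>
    ∫ y, K y * (1 - inner ℝ (x j : Ambient (d j)) (y j)) ^ 2 ∂(polyMeasure d) with hq
  have hqi : ∀ j, Integrable (fun y => K y * (1 - inner ℝ (x j : Ambient (d j)) (y j)) ^ 2)
      (polyMeasure d) := fun j => integrable_mul_continuous hKi ((hvc j).pow 2)
  have hq0 : ∀ j, 0 ≤ q j := fun j => integral_nonneg fun y => mul_nonneg (hK0 y) (sq_nonneg _)
  have hqA : ∀ j, q j ≤ A := fun j => by
    refine integral_mono (hqi j) hgi fun y => ?_
    refine mul_le_mul_of_nonneg_left ?_ (hK0 y)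
    exact pow_le_pow_left₀ (sub_nonneg.2 (inner_le_one_sphere _ _)) (one_sub_inner_le_gap x y j) 2
  have htr : ∀ j, (∑ b, B (blockBasis d j b) (blockBasis d j b)) / d j = τ j := fun j => by
    simp [hτ, hB, Matrix.trace, hessianBlock, iteratedFDeriv_two_apply]
  -- Uses `‖w_j‖² = 2 (1 - t_j) - (1 - t_j)²`. The `2` matches the doubling by symmetrization, and
  -- `q j ≤ A` goes into the remainder.
  have hquad : ∫ y, K y * B (tangent x y) (tangent x y) ∂(polyMeasure d) =
      ∑ j, τ j * (2 * a j - q j) := by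
    rw [integral_zonal_quadratic hz hKi hd B (hf.hessian_radial x)]
    refine Finset.sum_congr rfl fun j _ => ?_
    rw [htr]
    congr 1
    rw [ha, hq]
    simp only
    rw [← integral_const_mul, ← integral_sub
      ((integrable_mul_continuous hKi (hvc j)).const_mul 2) (hqi j)]
    refine integral_congr_ae (Eventually.of_forall fun y => ?_)
    simp only
    rw [norm_tangent_sq]
    ring
  rw [hRe, hquad] at hR
  have hsplit : ∑ j, τ j * (2 * a j - q j) = 2 * ∑ j, τ j * a j - ∑ j, τ j * q j := by
    rw [Finset.mul_sum, ← Finset.sum_sub_distrib]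
    exact Finset.sum_congr rfl fun j _ => by ring
  have hsq : |∑ j, τ j * q j| ≤ (∑ j, |τ j|) * A := by
    rw [Finset.sum_mul]
    refine (Finset.abs_sum_le_sum_abs _ _).trans (Finset.sum_le_sum fun j _ => ?_)
    rw [abs_mul, abs_of_nonneg (hq0 j)]
    exact mul_le_mul_of_nonneg_left (hqA j) (abs_nonneg _)
  rw [hsplit] at hR
  rw [abs_le] at hR hsq ⊢
  constructor <;> linarith [hR.1, hR.2, hsq.1, hsq.2]

/-- The asymptotic expansion of the smoothed density. -/
theorem RadialC4.isBigO_smoothed {f : Polysphere d → ℝ} (hf : RadialC4 d f)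
    (hd : ∀ j, 1 ≤ d j) (hL : IsKernel L) (x : Polysphere d) {h : ℕ → Fin r → ℝ}
    (hpos : ∀ n j, 0 < h n j) (hlim : Tendsto h atTop (nhds 0)) :
    (fun n => normConst d L (h n) * (∫ y, rawKernel L (h n) x y * f y ∂(polyMeasure d)) -
      (f x + ∑ j, h n j ^ 2 * ((hessianBlock d (radialExt d f) (toAmbient x) j).trace *
        kernelMoment d L j))) =O[atTop] fun n => ∑ j, h n j ^ 4 := by
  obtain ⟨c, hc, hlaw⟩ := exists_integral_polyMeasure_scaled hd
  obtain ⟨C₁, hC₁, hexp⟩ := hf.exists_integral_expansion hd hL x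
  -- Growth of degree two covers the three test functions `1`, `s_j` and `(∑ s_j)²`.
  obtain ⟨C₂, hC₂, hband⟩ := hL.exists_bandWeight_bound hd 2
  set τ : Fin r → ℝ := fun j => (hessianBlock d (radialExt d f) (toAmbient x) j).trace / d j with hτ
  set J₀ := limitIntegral d L fun _ => 1 with hJ₀
  have hJ₀0 : 0 < J₀ := hL.limitIntegral_one_pos hd
  set I : Fin r → ℝ := fun j => limitIntegral d L fun s => s j with hI
  set Q := limitIntegral d L fun s => (∑ j, s j) ^ 2 with hQ
  have hone : ∀ s ∈ posOrthant r, ∀ j, 1 ≤ 1 + s j := fun s hs j => by linarith [hs j]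
  have hband' : ∀ p : (Fin r → ℝ) → ℝ, Measurable p →
      (∀ s ∈ posOrthant r, |p s| ≤ ∏ j, (1 + s j) ^ 2) → ∀ n,
      |bandIntegral d L (h n) p - limitIntegral d L p| ≤ C₂ * ∑ j, h n j ^ 2 :=
    fun p hp hb n => ((hband p hp hb).2 (h n) (hpos n)).2
  have bnd1 := hband' (fun _ => 1) measurable_const fun s hs => by
    rw [abs_one]
    exact Finset.one_le_prod (fun j _ => one_le_pow₀ (hone s hs j))
  have bndj : ∀ j, ∀ n, |bandIntegral d L (h n) (fun s => s j) - I j| ≤ C₂ * ∑ j, h n j ^ 2 :=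
    fun j => hband' (fun s => s j) (measurable_pi_apply j) fun s hs => by
      rw [abs_of_pos (hs j), Finset.prod_pow]
      have h1 : s j ≤ ∑ i, s i :=
        Finset.single_le_sum (f := s) (fun i _ => (hs i).le) (Finset.mem_univ j)
      have h2 := sum_le_prod_one_add Finset.univ fun i => (hs i).le
      have h3 : 1 ≤ ∏ i, (1 + s i) := Finset.one_le_prod (fun j _ => hone s hs j)
      nlinarith
  have bndq := hband' (fun s => (∑ j, s j) ^ 2) (by fun_prop) fun s hs => by
    rw [abs_of_nonneg (sq_nonneg _), Finset.prod_pow]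
    exact pow_le_pow_left₀ (Finset.sum_nonneg fun i _ => (hs i).le)
      (sum_le_prod_one_add Finset.univ fun i => (hs i).le) 2
  have hη : Tendsto (fun n => ∑ j, h n j ^ 2) atTop (nhds 0) := by
    have : Tendsto (fun n => ∑ j, h n j ^ 2) atTop (nhds (∑ j : Fin r, (0 : ℝ) ^ 2)) :=
      tendsto_finsetSum _ fun j _ => ((tendsto_pi_nhds.1 hlim j).pow 2)
    simpa using this
  -- This keeps the normalizing integral `J` at least `J₀ / 2`, so ratios are stable.
  have hsmall : ∀ᶠ n in atTop, C₂ * ∑ j, h n j ^ 2 < J₀ / 2 := by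
    have : Tendsto (fun n => C₂ * ∑ j, h n j ^ 2) atTop (nhds (C₂ * 0)) := hη.const_mul C₂
    rw [mul_zero] at this
    exact this.eventually (gt_mem_nhds (by positivity))
  set T := ∑ j, |τ j| * (C₂ * (J₀ + |I j|) / (J₀ / 2 * J₀)) with hT
  set R := C₁ * (|Q| + J₀ / 2) / (J₀ / 2) with hR
  have hT0 : 0 ≤ T := Finset.sum_nonneg fun j _ => by positivity
  have hR0 : 0 ≤ R := by positivity
  refine IsBigO.of_bound ((T + R) * r) ?_
  filter_upwards [hsmall] with n hn
  set η := ∑ j, h n j ^ 2 with hηd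
  have hη0 : 0 ≤ η := Finset.sum_nonneg fun j _ => sq_nonneg _
  have hηj : ∀ j, h n j ^ 2 ≤ η := fun j =>
    Finset.single_le_sum (f := fun j => h n j ^ 2) (fun j _ => sq_nonneg _) (Finset.mem_univ j)
  set J := bandIntegral d L (h n) fun _ => 1 with hJ
  have hJJ : |J - J₀| ≤ C₂ * η := bnd1 n
  have hJl : J₀ / 2 ≤ J := by linarith [(abs_le.1 hJJ).1]
  have hJ0 : 0 < J := by linarith
  set ρ := c * rho d (h n) with hρ
  have hρ0 : 0 < ρ := mul_pos hc (Finset.prod_pos fun j _ => pow_pos (hpos n j) _)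
  have hlaw' : ∀ (z : Polysphere d) (p : (Fin r → ℝ) → ℝ), Measurable p →
      ∫ y, rawKernel L (h n) z y * p (scaledGap (h n) z y) ∂(polyMeasure d) =
        ρ * bandIntegral d L (h n) p := fun z p hp =>
    hlaw z (h n) (hpos n) (fun s => L s * p s) (hL.measurable.mul hp)
  -- The law of the scaled deviations is the same at the pole as at `x`, and the deviations are
  -- symmetric in the two points. Hence `ρ` cancels in every ratio.
  have hnorm : normConst d L (h n) = (ρ * J)⁻¹ := by
    rw [normConst]
    congr 1
    have := hlaw' (pole d) (fun _ => 1) measurable_const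
    simp only [mul_one] at this
    rw [← this]
    simp_rw [rawKernel_eq, scaledGap_comm (h n) _ (pole d)]
  have hK1 : ∫ y, rawKernel L (h n) x y ∂(polyMeasure d) = ρ * J := by
    simpa only [mul_one] using hlaw' x (fun _ => 1) measurable_const
  have hKj : ∀ j, ∫ y, rawKernel L (h n) x y * (1 - inner ℝ (x j : Ambient (d j)) (y j))
      ∂(polyMeasure d) = ρ * (h n j ^ 2 * bandIntegral d L (h n) fun s => s j) := by
    intro j
    rw [mul_left_comm, ← hlaw' x (fun s => s j) (measurable_pi_apply j), ← integral_const_mul]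
    refine integral_congr_ae (Eventually.of_forall fun y => ?_)
    have := (hpos n j).ne'
    simp only [scaledGap]
    field_simp
  have hKq : ∫ y, rawKernel L (h n) x y * gap x y ^ 2 ∂(polyMeasure d) ≤
      ρ * (η ^ 2 * bandIntegral d L (h n) fun s => (∑ j, s j) ^ 2) := by
    rw [mul_left_comm, ← hlaw' x (fun s => (∑ j, s j) ^ 2) (by fun_prop), ← integral_const_mul]
    have hKi := hL.integrable_rawKernel (h n) x
    have hsc := continuous_scaledGap (h n) x
    refine integral_mono (integrable_mul_continuous hKi (by unfold gap; fun_prop))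
      ((integrable_mul_continuous hKi (by fun_prop)).const_mul _) fun y => ?_
    simp only
    rw [mul_left_comm, ← mul_pow]
    exact mul_le_mul_of_nonneg_left (pow_le_pow_left₀ (gap_nonneg x y)
      (gap_le_scaledGap (hpos n) x y) 2) (hL.rawKernel_nonneg _ _ _)
  have hmain := hexp (h n)
  simp_rw [hK1, hKj] at hmain
  set E := ∫ y, rawKernel L (h n) x y * f y ∂(polyMeasure d) with hE
  set Jj : Fin r → ℝ := fun j => bandIntegral d L (h n) fun s => s j with hJj
  have hQn : bandIntegral d L (h n) (fun s => (∑ j, s j) ^ 2) ≤ |Q| + J₀ / 2 := by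
    have := (abs_le.1 (bndq n)).2
    linarith [le_abs_self Q]
  have hmain2 : |(ρ * J)⁻¹ * E - f x - ∑ j, τ j * (h n j ^ 2 * (Jj j / J))| ≤ R * η ^ 2 := by
    have e : (ρ * J)⁻¹ * E - f x - ∑ j, τ j * (h n j ^ 2 * (Jj j / J)) =
        (ρ * J)⁻¹ * (E - f x * (ρ * J) - ∑ j, τ j * (ρ * (h n j ^ 2 * Jj j))) := by
      rw [mul_sub, mul_sub, Finset.mul_sum]
      congr 1
      · field_simp
      · refine Finset.sum_congr rfl fun j _ => ?_
        field_simp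
    rw [e, abs_mul, abs_of_pos (by positivity : 0 < (ρ * J)⁻¹)]
    calc (ρ * J)⁻¹ * |E - f x * (ρ * J) - ∑ j, τ j * (ρ * (h n j ^ 2 * Jj j))|
        ≤ (ρ * J)⁻¹ * (C₁ * (ρ * (η ^ 2 * (|Q| + J₀ / 2)))) := by
          refine mul_le_mul_of_nonneg_left (hmain.trans ?_) (by positivity)
          exact mul_le_mul_of_nonneg_left (hKq.trans (by gcongr)) hC₁
      _ = C₁ * (|Q| + J₀ / 2) / J * η ^ 2 := by field_simp
      _ ≤ R * η ^ 2 := by rw [hR]; gcongr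
  have hratio : ∀ j, |Jj j / J - I j / J₀| ≤ C₂ * (J₀ + |I j|) / (J₀ / 2 * J₀) * η := by
    intro j
    have e : Jj j / J - I j / J₀ = ((Jj j - I j) * J₀ - I j * (J - J₀)) / (J * J₀) := by
      field_simp
      ring
    rw [e, abs_div, abs_of_pos (mul_pos hJ0 hJ₀0)]
    have h1 : |(Jj j - I j) * J₀ - I j * (J - J₀)| ≤ C₂ * (J₀ + |I j|) * η := by
      refine (abs_sub _ _).trans ?_
      rw [abs_mul, abs_mul, abs_of_pos hJ₀0]
      have a1 := mul_le_mul_of_nonneg_right (bndj j n) hJ₀0.le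
      have a2 := mul_le_mul_of_nonneg_left hJJ (abs_nonneg (I j))
      calc _ ≤ C₂ * η * J₀ + |I j| * (C₂ * η) := add_le_add a1 a2
        _ = _ := by ring
    calc _ ≤ C₂ * (J₀ + |I j|) * η / (J₀ / 2 * J₀) := by gcongr
      _ = _ := by ring
  have hrest : |∑ j, τ j * (h n j ^ 2 * (Jj j / J)) - ∑ j, τ j * (h n j ^ 2 * (I j / J₀))| ≤
      T * η ^ 2 := by
    rw [← Finset.sum_sub_distrib, hT, Finset.sum_mul]
    refine (Finset.abs_sum_le_sum_abs _ _).trans (Finset.sum_le_sum fun j _ => ?_)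
    rw [← mul_sub, ← mul_sub, abs_mul, abs_mul, abs_of_nonneg (sq_nonneg (h n j)), mul_assoc]
    refine mul_le_mul_of_nonneg_left ?_ (abs_nonneg _)
    calc _ ≤ η * (C₂ * (J₀ + |I j|) / (J₀ / 2 * J₀) * η) :=
          mul_le_mul (hηj j) (hratio j) (abs_nonneg _) hη0
      _ = _ := by ring
  have hkm : ∑ j, h n j ^ 2 * ((hessianBlock d (radialExt d f) (toAmbient x) j).trace *
      kernelMoment d L j) = ∑ j, τ j * (h n j ^ 2 * (I j / J₀)) := by
    refine Finset.sum_congr rfl fun j _ => ?_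
    rw [kernelMoment_eq d, ← hJ₀, hτ]
    have : (d j : ℝ) ≠ 0 := Nat.cast_ne_zero.2 (by have := hd j; omega)
    simp only [hI]
    field_simp
  -- Cauchy–Schwarz, which accounts for the factor `r` in the final constant.
  have hη4 : η ^ 2 ≤ r * ∑ j, h n j ^ 4 := by
    have := sq_sum_le_card_mul_sum_sq (s := (Finset.univ : Finset (Fin r)))
      (f := fun j => h n j ^ 2)
    simpa [← pow_mul] using this
  rw [hnorm, hkm, Real.norm_eq_abs, Real.norm_eq_abs,
    abs_of_nonneg (Finset.sum_nonneg fun j _ => by positivity : 0 ≤ ∑ j, h n j ^ 4)]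
  have htot : |(ρ * J)⁻¹ * E - (f x + ∑ j, τ j * (h n j ^ 2 * (I j / J₀)))| ≤
      (T + R) * η ^ 2 := by
    rw [abs_le] at hmain2 hrest ⊢
    constructor <;> linarith [hmain2.1, hmain2.2, hrest.1, hrest.2]
  calc _ ≤ (T + R) * η ^ 2 := htot
    _ ≤ (T + R) * (r * ∑ j, h n j ^ 4) := by gcongr
    _ = _ := by ring

end Kernel

end PolyKDE

/-! ### From the mean of the estimator to the smoothed density. -/

theorem corollary1 {r : ℕ} (d : Fin r → ℕ) (hd : ∀ j, 1 ≤ d j)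
    (f : PolyKDE.Polysphere d → ℝ) (hf : PolyKDE.IsDensity d f)
    (hA1 : PolyKDE.RadialC4 d f)
    (L : (Fin r → ℝ) → ℝ) (hA2 : PolyKDE.IsKernel L)
    (h : ℕ → Fin r → ℝ) (hA3 : PolyKDE.IsBandwidth d h)
    {Ω : Type*} [MeasurableSpace Ω] (P : Measure Ω) [IsProbabilityMeasure P]
    (X : ℕ → Ω → PolyKDE.Polysphere d) (hindep : iIndepFun X P)
    (hlaw : ∀ i, HasLaw (X i)
      ((PolyKDE.polyMeasure d).withDensity fun y => ENNReal.ofReal (f y)) P)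
    (x : PolyKDE.Polysphere d) :
    (∀ n : ℕ, Integrable (fun ω => PolyKDE.kde d L (h n) (fun i : Fin n => X i ω) x) P) ∧
    (fun n : ℕ =>
        (∫ ω, PolyKDE.kde d L (h n) (fun i : Fin n => X i ω) x ∂P) -
          (f x + (fun j => h n j ^ 2) ⬝ᵥ
            (PolyKDE.curvatureMatrix d (PolyKDE.radialExt d f) (PolyKDE.toAmbient x) *ᵥ
              PolyKDE.kernelMoment d L)))
      =O[atTop] fun n : ℕ => ∑ j, h n j ^ 4 := by
  have hterm : ∀ n i, Integrable (fun ω => PolyKDE.normKernel d L (h n) x (X i ω)) P := by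
    intro n i
    obtain ⟨M, hM⟩ := hA2.exists_rawKernel_bound (h n) x
    refine Integrable.const_mul (Integrable.of_bound ?_ M (Eventually.of_forall fun ω => hM _)) _
    exact ((hA2.measurable_rawKernel (h n) x).comp_aemeasurable
      (hlaw i).aemeasurable).aestronglyMeasurable
  refine ⟨fun n => ?_, ?_⟩
  · unfold PolyKDE.kde
    exact (integrable_finsetSum _ fun (i : Fin n) _ => hterm n i).const_mul _
  have hmean : ∀ n i, ∫ ω, PolyKDE.normKernel d L (h n) x (X i ω) ∂P =
      PolyKDE.normConst d L (h n) *
        ∫ y, PolyKDE.rawKernel L (h n) x y * f y ∂(PolyKDE.polyMeasure d) := by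
    intro n i
    simp only [PolyKDE.normKernel]
    rw [integral_const_mul]
    congr 1
    have h1 := (hlaw i).integral_comp
      (hA2.measurable_rawKernel (h n) x).aestronglyMeasurable
    have h2 := integral_withDensity_eq_integral_toReal_smul (μ := PolyKDE.polyMeasure d)
      (f := fun y => ENNReal.ofReal (f y)) hA1.continuous.measurable.ennreal_ofReal
      (Eventually.of_forall fun _ => ENNReal.ofReal_lt_top) (PolyKDE.rawKernel L (h n) x)
    refine h1.trans (h2.trans (integral_congr_ae (Eventually.of_forall fun y => ?_)))
    simp only [smul_eq_mul]
    rw [ENNReal.toReal_ofReal (hf.nonneg y), mul_comm]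
  refine (hA1.isBigO_smoothed hd hA2 x hA3.pos hA3.tendsto_zero).congr' ?_ EventuallyEq.rfl
  -- For `n = 0` the estimator is `0` by the convention `1 / 0 = 0`, so the identity for the mean is
  -- asserted only for positive `n`.
  filter_upwards [eventually_gt_atTop 0] with n hn
  have hn' : (n : ℝ) ≠ 0 := Nat.cast_ne_zero.2 hn.ne'
  have hE : ∫ ω, PolyKDE.kde d L (h n) (fun i : Fin n => X i ω) x ∂P =
      PolyKDE.normConst d L (h n) *
        ∫ y, PolyKDE.rawKernel L (h n) x y * f y ∂(PolyKDE.polyMeasure d) := by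
    simp only [PolyKDE.kde]
    rw [integral_const_mul, integral_finsetSum _ fun (i : Fin n) _ => hterm n i]
    simp_rw [hmean]
    rw [Finset.sum_const, Finset.card_univ, Fintype.card_fin, nsmul_eq_mul]
    field_simp
  rw [hE]
  simp [dotProduct, PolyKDE.curvatureMatrix, mulVec_diagonal]
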